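/- Let $T$ be a tree on $n$ nodes with an arbitrarily chosen root $r$, let $k$ agents occupy the nodes of a $k$-element set $A$, and let $B$ be a $k$-element set of targets (possibly meeting $A$). Let $\mathit{OPT}$ be the minimum number of moves of a feasible plan of the unlabeled pebble motion problem for $(T,A,B)$, i.e. of a sequence of moves, each taking one pebble to an adjacent pebble-less node, that brings all pebbles from $A$ to targets. For a node $u$ with subtree $T_u$ let $d(u)=|B\cap T_u|-|A\cap T_u|$ be its initial demand; let $l(u)$ be an initially empty list of times with $\max l(u)=0$ when it is empty, and let $s(u)$ be initially $0$. $\mathit{send\_agent}(u,t)$: if $d(u)<0$, append $t+1$ to $l(\mathrm{parent}(u))$, output the move $(u,\mathrm{parent}(u),t)$ and increase $d(u)$ by $1$; otherwise, if $u$ has a child $v$ with $d(v)>0$, pick one, append $t+1$ to $l(v)$, output the move $(u,v,t)$ and decrease $d(v)$ by $1$; otherwise do nothing. $\mathit{direct\_traffic}(u)$: if there is initially an agent at $u$, insert $s(u)$ at the start of $l(u)$; for each child $v$ of $u$ with $d(v)<0$, set $s(v):=\max(s(u)-1,\max l(u),0)$ and call $\mathit{direct\_traffic}(v)$; for each $t$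 in $l(u)$ call $\mathit{send\_agent}(u,t)$; mark $u$ as processed; for each child $v$ of $u$ not yet processed call $\mathit{direct\_traffic}(v)$. The input is the rooted tree, given by the references of the nodes to their parents, together with $A$ and $B$. The program reads it, builds the lists of children, computes $d$ by a postorder traversal, and runs $\mathit{direct\_traffic}(r)$. The lists are linked lists; each node stores the list of its children of positive demand, and $\mathit{send\_agent}$ picks the first child in that list and removes it when its demand reaches $0$; $\max l(u)$ is read off as the last entry of $l(u)$. Running time is measured on a random access machine with logarithmic costs: reading, writing, comparing or adding integers (node references and other addresses included) is charged the number of their bits, and a procedure call is charged the bits of its arguments, of the saved registers and of the depth of the call stack. **Theorem.** For every such input the program terminates and makes exactly $\mathit{OPT}+k$ calls to $\mathit{send\_agent}$. There is an absolute constant $K$ such that, for every such input with $n\ge 2$, each of these calls takes time at most $K\log n$, and the whole computation takes time at most $K(n\log n+\mathit{OPT}\log n)$. -/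

import Mathlib

/-! ## Unlabeled pebble motion on a tree and the optimal plan length -/

namespace UPMT

/-- `IsPlan T P ms Q`: starting from the set `P` of nodes carrying a pebble, the sequence of moves
`ms` is legal in `T` and leads to the set `Q`. A move `(u, v)` moves a single pebble from its
current node `u` to an adjacent node `v` that carries no pebble. -/
def IsPlan {V : Type*} [DecidableEq V] (T : SimpleGraph V) :
    Finset V → List (V × V) → Finset V → Prop
  | P, [], Q => P = Q
  | P, (u, v) :: ms, Q =>
      u ∈ P ∧ v ∉ P ∧ T.Adj u v ∧ IsPlan T (insert v (P.erase u)) ms Q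

/-- A plan is feasible for starting nodes `A` and targets `B` if it moves every pebble to a target. -/
def IsFeasible {V : Type*} [DecidableEq V] (T : SimpleGraph V) (A B : Finset V)
    (ms : List (V × V)) : Prop :=
  ∃ Q, IsPlan T A ms Q ∧ Q ⊆ B

/-- The minimum number of moves of a feasible plan. -/
noncomputable def OPT {V : Type*} [DecidableEq V] (T : SimpleGraph V) (A B : Finset V) : ℕ :=
  sInf {m | ∃ ms : List (V × V), IsFeasible T A B ms ∧ ms.length = m}

/-- The parent of `u` in the tree `T` rooted at `r`: the second node of the path from `u` to `r`
(for `u = r` this is `r` itself). -/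
noncomputable def parent {V : Type*} {T : SimpleGraph V} (hT : T.IsTree) (r u : V) : V :=
  (hT.existsUnique_path u r).choose.snd

end UPMT

/-! ## A random access machine with logarithmic costs

The machine has finitely many registers, finitely many arrays of integers (initially `0` wherever
they do not hold the input), a write-only output, and procedures that may call each other
recursively. Reading, writing, computing or comparing integers is charged the number of their bits;
this includes the integers used as addresses. -/

namespace RAM

/-- Registers. -/
inductive Reg
  | u | v | w | t | c | n
  deriving DecidableEq

/-- Arrays. `par`, `agent`, `target` hold the input; `child`, `sib` are the lists of all children
(first child, next sibling); `d` is the demand; `pos`, `nextPos` are the lists of children with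
positive demand; `s` and `processed` are attributes of nodes; `lHead`, `lTail` hold the first and
the last cell of the list `l(u)`, whose cells `c` have content `val c` and successor `link c`;
`free 0` is the number of cells in use. The null reference is `0`. -/
inductive Field
  | par | agent | target | child | sib | d | pos | nextPos | s | processed
  | lHead | lTail | val | link | free
  deriving DecidableEq

/-- Names of procedures. -/
inductive Proc
  | main | demand | directTraffic | sendAgent
  deriving DecidableEq

/-- The contents of the registers and of the arrays, and the moves `(u, v, t)` output so far. -/
structure State where
  reg : Reg → ℤ
  mem : Field → ℤ → ℤ
  out : List (ℤ × ℤ × ℤ)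

/-- The number of bits of an integer (one of them for the sign). -/
def bits (z : ℤ) : ℕ := z.natAbs.size + 1

/-- Expressions; `rd f e` is the entry of the array `f` at the address `e`. -/
inductive Expr
  | lit (z : ℤ)
  | get (x : Reg)
  | rd (f : Field) (e : Expr)
  | add (a b : Expr)
  | sub (a b : Expr)

def Expr.eval (σ : State) : Expr → ℤ
  | .lit z => z
  | .get x => σ.reg x
  | .rd f e => σ.mem f (e.eval σ)
  | .add a b => a.eval σ + b.eval σ
  | .sub a b => a.eval σ - b.eval σ

/-- The total number of bits of all integers that occur in the evaluation. -/
def Expr.cost (σ : State) : Expr → ℕ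
  | .lit z => bits z
  | .get x => bits (σ.reg x)
  | .rd f e => e.cost σ + bits ((Expr.rd f e).eval σ)
  | .add a b => a.cost σ + b.cost σ + bits ((Expr.add a b).eval σ)
  | .sub a b => a.cost σ + b.cost σ + bits ((Expr.sub a b).eval σ)

/-- Comparisons. -/
inductive Test
  | eq (a b : Expr)
  | ne (a b : Expr)
  | lt (a b : Expr)

def Test.holds (σ : State) : Test → Prop
  | .eq a b => a.eval σ = b.eval σ
  | .ne a b => a.eval σ ≠ b.eval σ
  | .lt a b => a.eval σ < b.eval σ

def Test.cost (σ : State) : Test → ℕ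
  | .eq a b => a.cost σ + b.cost σ + 1
  | .ne a b => a.cost σ + b.cost σ + 1
  | .lt a b => a.cost σ + b.cost σ + 1

inductive Stmt
  | skip
  | set (x : Reg) (e : Expr)
  | wr (f : Field) (i e : Expr)
  | emit (a b c : Expr)
  | seq (p q : Stmt)
  | cond (b : Test) (p q : Stmt)
  | loop (b : Test) (p : Stmt)
  | call (f : Proc) (a b : Expr)

/-- Sequential composition of a list of statements. -/
def block : List Stmt → Stmt
  | [] => .skip
  | p :: ps => .seq p (block ps)

def State.setReg (σ : State) (x : Reg) (z : ℤ) : State :=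
  { σ with reg := fun y => if y = x then z else σ.reg y }

def State.write (σ : State) (f : Field) (i z : ℤ) : State :=
  { σ with mem := fun g j => if g = f ∧ j = i then z else σ.mem g j }

def State.emit (σ : State) (a b c : ℤ) : State :=
  { σ with out := σ.out ++ [(a, b, c)] }

/-- The state in which the body of a procedure with arguments `a` and `b` starts: the arguments are
in the registers `u` and `t`, the other registers are `0`. -/
def State.enter (σ : State) (a b : ℤ) : State :=
  { σ with reg := fun y => if y = .u then a else if y = .t then b else 0 }

/-- The cost of passing two arguments and saving all registers at nesting depth `k` of the
call stack. -/
def callCost (k : ℕ) (σ : State) (a b : Expr) : ℕ :=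
  a.cost σ + b.cost σ + bits k +
    (bits (σ.reg .u) + bits (σ.reg .v) + bits (σ.reg .w) + bits (σ.reg .t) + bits (σ.reg .c)
      + bits (σ.reg .n))

/-- `Exec code k p σ σ' time calls`: at nesting depth `k` of the call stack, the statement `p`
started in the state `σ` terminates in the state `σ'` after `time` steps; `calls` lists all
procedure calls made meanwhile (nested ones included), each with the time it took. -/
inductive Exec (code : Proc → Stmt) :
    ℕ → Stmt → State → State → ℕ → List (Proc × ℕ) → Prop
  | skip {k σ} : Exec code k .skip σ σ 1 []
  | set {k σ} (x e) :
      Exec code k (.set x e) σ (σ.setReg x (e.eval σ)) (e.cost σ + 1) []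
  | wr {k σ} (f i e) :
      Exec code k (.wr f i e) σ (σ.write f (i.eval σ) (e.eval σ)) (i.cost σ + e.cost σ + 1) []
  | emit {k σ} (a b c) :
      Exec code k (.emit a b c) σ (σ.emit (a.eval σ) (b.eval σ) (c.eval σ))
        (a.cost σ + b.cost σ + c.cost σ + 1) []
  | seq {k p q σ σ₁ σ₂ t₁ t₂ L₁ L₂} :
      Exec code k p σ σ₁ t₁ L₁ → Exec code k q σ₁ σ₂ t₂ L₂ →
      Exec code k (.seq p q) σ σ₂ (t₁ + t₂) (L₁ ++ L₂)
  | cond_true {k b p q σ σ' t L} :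
      b.holds σ → Exec code k p σ σ' t L →
      Exec code k (.cond b p q) σ σ' (b.cost σ + t) L
  | cond_false {k b p q σ σ' t L} :
      ¬ b.holds σ → Exec code k q σ σ' t L →
      Exec code k (.cond b p q) σ σ' (b.cost σ + t) L
  | loop_true {k b p σ σ₁ σ₂ t₁ t₂ L₁ L₂} :
      b.holds σ → Exec code k p σ σ₁ t₁ L₁ → Exec code k (.loop b p) σ₁ σ₂ t₂ L₂ →
      Exec code k (.loop b p) σ σ₂ (b.cost σ + t₁ + t₂) (L₁ ++ L₂)
  | loop_false {k b p σ} :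
      ¬ b.holds σ → Exec code k (.loop b p) σ σ (b.cost σ) []
  | call {k f a b σ σ' t L} :
      Exec code (k + 1) (code f) (σ.enter (a.eval σ) (b.eval σ)) σ' t L →
      Exec code k (.call f a b) σ { σ' with reg := σ.reg } (callCost k σ a b + t)
        ((f, callCost k σ a b + t) :: L)

/-- The machine is deterministic: final state, running time and list of calls are determined by
the program and the initial state. -/
theorem Exec.deterministic {code : Proc → Stmt} {k p σ σ₁ t₁ L₁}
    (h₁ : Exec code k p σ σ₁ t₁ L₁) :
    ∀ {σ₂ t₂ L₂}, Exec code k p σ σ₂ t₂ L₂ → σ₁ = σ₂ ∧ t₁ = t₂ ∧ L₁ = L₂ := by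
  induction h₁ with
  | skip => intro _ _ _ h₂; cases h₂; simp
  | set => intro _ _ _ h₂; cases h₂; simp
  | wr => intro _ _ _ h₂; cases h₂; simp
  | emit => intro _ _ _ h₂; cases h₂; simp
  | seq _ _ ih₁ ih₂ =>
    intro _ _ _ h₂
    cases h₂ with
    | seq a b =>
      obtain ⟨rfl, rfl, rfl⟩ := ih₁ a
      obtain ⟨rfl, rfl, rfl⟩ := ih₂ b
      simp
  | cond_true hb _ ih =>
    intro _ _ _ h₂
    cases h₂ with
    | cond_true _ a => obtain ⟨rfl, rfl, rfl⟩ := ih a; simp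
    | cond_false hn _ => exact absurd hb hn
  | cond_false hb _ ih =>
    intro _ _ _ h₂
    cases h₂ with
    | cond_false _ a => obtain ⟨rfl, rfl, rfl⟩ := ih a; simp
    | cond_true hn _ => exact absurd hn hb
  | loop_true hb _ _ ih₁ ih₂ =>
    intro _ _ _ h₂
    cases h₂ with
    | loop_true _ a b =>
      obtain ⟨rfl, rfl, rfl⟩ := ih₁ a
      obtain ⟨rfl, rfl, rfl⟩ := ih₂ b
      simp
    | loop_false hn => exact absurd hb hn
  | loop_false hb =>
    intro _ _ _ h₂
    cases h₂ with
    | loop_true hn _ _ => exact absurd hn hb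
    | loop_false _ => simp
  | call _ ih =>
    intro _ _ _ h₂
    cases h₂ with
    | call a => obtain ⟨rfl, rfl, rfl⟩ := ih a; simp

/-! ## The algorithm -/

open RAM.Expr RAM.Stmt RAM.Test

abbrev U : Expr := get .u
abbrev V : Expr := get .v
abbrev W : Expr := get .w
abbrev Tm : Expr := get .t
abbrev C : Expr := get .c
abbrev N : Expr := get .n

/-- Put a new list cell with content `e` and no successor into the register `c`. -/
def newCell (e : Expr) : Stmt := block [
  set .c (add (rd .free (lit 0)) (lit 1)),
  wr .free (lit 0) C,
  wr .val C e]

/-- Insert `e` at the start of `l(x)`. -/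
def insertFront (x e : Expr) : Stmt := block [
  newCell e,
  wr .link C (rd .lHead x),
  cond (eq (rd .lHead x) (lit 0)) (wr .lTail x C) skip,
  wr .lHead x C]

/-- Append `e` at the end of `l(x)`. -/
def append (x e : Expr) : Stmt := block [
  newCell e,
  cond (eq (rd .lTail x) (lit 0))
    (wr .lHead x C)
    (wr .link (rd .lTail x) C),
  wr .lTail x C]

/-- `demand(u)`: compute `d` on the subtree `T_u` by a postorder traversal, and store the children
with positive demand of each of its nodes in a list. -/
def demandCode : Stmt := block [
  wr .d U (sub (rd .target U) (rd .agent U)),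
  set .v (rd .child U),
  loop (ne V (lit 0)) (block [
    call .demand V (lit 0),
    wr .d U (add (rd .d U) (rd .d V)),
    cond (lt (lit 0) (rd .d V))
      (block [
        wr .nextPos V (rd .pos U),
        wr .pos U V])
      skip,
    set .v (rd .sib V)])]

/-- `send_agent(u, t)`. -/
def sendAgentCode : Stmt :=
  cond (lt (rd .d U) (lit 0))
    (block [
      append (rd .par U) (add Tm (lit 1)),
      emit U (rd .par U) Tm,
      wr .d U (add (rd .d U) (lit 1))])
    (cond (ne (rd .pos U) (lit 0))
      (block [
        set .v (rd .pos U),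
        append V (add Tm (lit 1)),
        emit U V Tm,
        wr .d V (sub (rd .d V) (lit 1)),
        cond (eq (rd .d V) (lit 0)) (wr .pos U (rd .nextPos V)) skip])
      skip)

/-- `direct_traffic(u)`. As `l(u)` is sorted, its last entry `val (lTail u)` is its maximum; this
entry is `0` if `l(u)` is empty, in accordance with the convention `max l(u) = 0`. -/
def directTrafficCode : Stmt := block [
  -- if agent(u) = 1, insert s(u) at the start of l(u)
  cond (eq (rd .agent U) (lit 1)) (insertFront U (rd .s U)) skip,
  -- for each child v of u with d(v) < 0: s(v) := max (s(u) - 1, max l(u), 0); direct_traffic(v)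
  set .v (rd .child U),
  loop (ne V (lit 0)) (block [
    cond (lt (rd .d V) (lit 0))
      (block [
        set .w (lit 0),
        cond (lt W (sub (rd .s U) (lit 1))) (set .w (sub (rd .s U) (lit 1))) skip,
        cond (lt W (rd .val (rd .lTail U))) (set .w (rd .val (rd .lTail U))) skip,
        wr .s V W,
        call .directTraffic V (lit 0)])
      skip,
    set .v (rd .sib V)]),
  -- for each time t in l(u): send_agent(u, t)
  set .c (rd .lHead U),
  loop (ne C (lit 0)) (block [
    call .sendAgent U (rd .val C),
    set .c (rd .link C)]),
  -- mark u as processed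
  wr .processed U (lit 1),
  -- for each child v of u not yet processed: direct_traffic(v)
  set .v (rd .child U),
  loop (ne V (lit 0)) (block [
    cond (eq (rd .processed V) (lit 0)) (call .directTraffic V (lit 0)) skip,
    set .v (rd .sib V)])]

/-- The whole computation: read the input (the number `n` of nodes in the register `n`, the arrays
`par`, `agent`, `target`), build the lists of children, find the root, compute the demands, and
call `direct_traffic` on the root. -/
def mainCode : Stmt := block [
  set .u (lit 1),
  loop (lt U (add N (lit 1))) (block [
    set .v (rd .par U),
    cond (eq V (lit 0))
      (set .w U)
      (block [
        wr .sib U (rd .child V),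
        wr .child V U]),
    set .u (add U (lit 1))]),
  call .demand W (lit 0),
  call .directTraffic W (lit 0)]

def code : Proc → Stmt
  | .main => mainCode
  | .demand => demandCode
  | .directTraffic => directTrafficCode
  | .sendAgent => sendAgentCode

/-- The reference to a node: the node `u` is referred to by the integer `u + 1`. -/
def nodeRef {n : ℕ} (u : Fin n) : ℤ := (u.val : ℤ) + 1

/-- The array whose entries at the addresses `1, …, n` are the values of `f`. -/
def inputArray {n : ℕ} (f : Fin n → ℤ) (i : ℤ) : ℤ :=
  if h : 1 ≤ i ∧ i ≤ n then f ⟨(i - 1).toNat, by omega⟩ else 0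

open Classical in
/-- The initial state for the tree `T` on `n` nodes with root `r`, agents on `A` and targets `B`.
The tree is given by the references of the nodes to their parents, the one of the root being null. -/
noncomputable def initState {n : ℕ} {T : SimpleGraph (Fin n)} (hT : T.IsTree) (r : Fin n)
    (A B : Finset (Fin n)) : State where
  reg := fun x => if x = .n then (n : ℤ) else 0
  mem := fun f => match f with
    | .par => inputArray fun u : Fin n => if u = r then 0 else nodeRef (UPMT.parent hT r u)
    | .agent => inputArray fun u : Fin n => if u ∈ A then 1 else 0
    | .target => inputArray fun u : Fin n => if u ∈ B then 1 else 0
    | _ => fun _ => 0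
  out := []

/-- The running times of the calls to `send_agent`, in a list of procedure calls. -/
def sendAgentTimes (calls : List (Proc × ℕ)) : List ℕ :=
  (calls.filter fun c => c.1 = .sendAgent).map Prod.snd

end RAM

/-! For a non-root node v, the demand d(v) is the net number of pebbles that must cross the edge
from the parent of v down to v. A move along this edge changes d at v alone, by exactly one, so
Σ|d(v)| moves are necessary. Conversely, let the pebbles occupy a set P ≠ B with |P| = |B|, and let
p be the indicator of P. The recursion d(u) = [u ∈ B] - p(u) + Σ d(c) over the children c of u,
together with d(root) = 0, gives Σ p(u)([u ∈ B] - p(u)) = Σ (p(c) - p(par c)) d(c), the last sum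
over c ≠ root. If no move lowered Σ|d|, every term on the right would be nonnegative, while the left
side is -|P \ B| < 0. Hence OPT = Σ|d(v)| (`exists_move`, `imbalance_le_length`,
`OPT_eq_imbalance`).

At each node u, `direct_traffic` calls `send_agent` once per entry of l(u). When this loop starts,
l(u) has [u ∈ A] + d(u)⁺ + Σ d(c)⁻ entries: the agent at u, the arrivals from the parent and those
from the children. The outstanding transports number d(u)⁻ + Σ d(c)⁺. By the recursion for d the
difference is [u ∈ B] ≥ 0, so the entries suffice: the demands of u and of its children all become
0, and each child of nonnegative demand has its complete list of arrivals before it is called.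
Summing the lengths over all u gives k + Σ d⁺ + Σ d⁻ = OPT + k (`Send.spec`, `trafficSpec`,
`totalSends_root`). The stored times influence no branch except those computing s, so they play no
role in this count.

For the running time, steps are counted first with unit costs. A step increases the largest absolute
value by at most one, unless it stores a value bounded by n (a partial sum of demands); the
recursion depth also grows by at most one per step. After N steps every integer is therefore at most
n + N. Since N = O(n + OPT) and OPT ≤ n², all integers have O(log n) bits, and a step of the fixed
program involves boundedly many of them (`Steps.exists_exec`). A single call to `send_agent` has at
most 40 steps in its body. -/

namespace RAM

/-! ## Counting steps

`Steps n p σ σ' N m` is the semantics of the machine with unit costs: `p` takes `σ` to `σ'` in `N`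
steps and makes `m` calls to `send_agent`. Values are increased by at most one per step, except for
those bounded by `n`, so that running times with logarithmic costs can be read off. -/

/-- Expressions without arithmetic. -/
def Expr.flat : Expr → Bool
  | .lit z => z.natAbs ≤ 1
  | .get _ => true
  | .rd _ e => e.flat
  | .add _ _ => false
  | .sub _ _ => false

/-- Expressions whose value exceeds those of the entries of the memory by at most one. -/
def Expr.mild : Expr → Bool
  | .add a (.lit z) => a.flat && z.natAbs ≤ 1
  | .sub a (.lit z) => a.flat && z.natAbs ≤ 1
  | e => e.flat

/-- The number of nodes of an expression. -/
def Expr.length : Expr → ℕ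
  | .lit _ => 1
  | .get _ => 1
  | .rd _ e => e.length + 1
  | .add a b => a.length + b.length + 1
  | .sub a b => a.length + b.length + 1

/-- All literals are at most one in absolute value. -/
def Expr.unitLits : Expr → Bool
  | .lit z => z.natAbs ≤ 1
  | .get _ => true
  | .rd _ e => e.unitLits
  | .add a b => a.unitLits && b.unitLits
  | .sub a b => a.unitLits && b.unitLits

def Expr.short (e : Expr) : Bool := e.unitLits && e.length ≤ 8

def Test.short : Test → Bool
  | .eq a b => a.short && b.short
  | .ne a b => a.short && b.short
  | .lt a b => a.short && b.short

def Stmt.short : Stmt → Bool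
  | .skip => true
  | .set _ e => e.short
  | .wr _ i e => i.short && e.short
  | .emit a b c => a.short && b.short && c.short
  | .seq p q => p.short && q.short
  | .cond b p q => b.short && p.short && q.short
  | .loop b p => b.short && p.short
  | .call _ a b => a.short && b.short

/-- A finite check on the fixed program text. It makes the cost of one step a constant multiple of
the largest bit length. -/
theorem code_short (f : Proc) : (code f).short = true := by
  cases f <;> decide

/-- All registers and all entries of the memory are at most `M` in absolute value. -/
structure State.Bdd (M : ℕ) (σ : State) : Prop where
  reg : ∀ x, (σ.reg x).natAbs ≤ M
  mem : ∀ f i, (σ.mem f i).natAbs ≤ M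

theorem State.Bdd.mono {M M' : ℕ} {σ : State} (h : σ.Bdd M) (hM : M ≤ M') : σ.Bdd M' :=
  ⟨fun x => (h.reg x).trans hM, fun f i => (h.mem f i).trans hM⟩

theorem State.Bdd.setReg {M : ℕ} {σ : State} (h : σ.Bdd M) {z : ℤ} (hz : z.natAbs ≤ M) (x : Reg) :
    (σ.setReg x z).Bdd M := by
  refine ⟨fun y => ?_, h.mem⟩
  simp only [State.setReg]
  split_ifs
  exacts [hz, h.reg y]

theorem State.Bdd.write {M : ℕ} {σ : State} (h : σ.Bdd M) {z : ℤ} (hz : z.natAbs ≤ M) (f : Field)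
    (i : ℤ) : (σ.write f i z).Bdd M := by
  refine ⟨h.reg, fun g j => ?_⟩
  simp only [State.write]
  split_ifs
  exacts [hz, h.mem g j]

theorem State.Bdd.enter {M : ℕ} {σ : State} (h : σ.Bdd M) {a b : ℤ} (ha : a.natAbs ≤ M)
    (hb : b.natAbs ≤ M) : (σ.enter a b).Bdd M := by
  refine ⟨fun y => ?_, h.mem⟩
  simp only [State.enter]
  split_ifs
  exacts [ha, hb, by simp]

theorem bits_mono {a b : ℤ} (h : a.natAbs ≤ b.natAbs) : bits a ≤ bits b := by
  unfold bits
  have := Nat.size_le_size h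
  omega

theorem bits_le {M X : ℕ} {z : ℤ} (hz : z.natAbs ≤ 8 * M) (hX : M ≤ X) : bits z ≤ bits (8 * X) :=
  bits_mono (by omega)

theorem Expr.natAbs_eval_le {M : ℕ} {σ : State} (h : σ.Bdd M) (hM : 1 ≤ M) (e : Expr)
    (he : e.unitLits) : (e.eval σ).natAbs ≤ e.length * M := by
  induction e with
  | lit z => simp [Expr.unitLits] at he; simp [Expr.eval, Expr.length]; omega
  | get x => simpa [Expr.eval, Expr.length] using h.reg x
  | rd f e _ =>
    refine (h.mem f _).trans ?_
    simp [Expr.length, add_mul]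
  | add a b iha ihb =>
    simp [Expr.unitLits] at he
    have := iha he.1
    have := ihb he.2
    simp only [Expr.eval, Expr.length, add_mul]
    omega
  | sub a b iha ihb =>
    simp [Expr.unitLits] at he
    have := iha he.1
    have := ihb he.2
    simp only [Expr.eval, Expr.length, add_mul]
    omega

/-- Every node of the expression has a value of absolute value at most `8 * M`, so it contributes at
most one summand `bits (8 * X)`. The bound uses `X`, fixed for a whole run, because `M` grows along
the run. -/
theorem Expr.cost_le_length {M X : ℕ} {σ : State} (h : σ.Bdd M) (hM : 1 ≤ M) (hX : M ≤ X)
    (e : Expr) (he : e.unitLits) (hl : e.length ≤ 8) :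
    e.cost σ ≤ e.length * bits (8 * X) := by
  have hv := e.natAbs_eval_le h hM he
  have hv' : bits (e.eval σ) ≤ bits (8 * X) :=
    bits_le (hv.trans (Nat.mul_le_mul_right _ hl)) hX
  induction e with
  | lit z => simpa [Expr.cost, Expr.length, Expr.eval] using hv'
  | get x => simpa [Expr.cost, Expr.length, Expr.eval] using hv'
  | rd f e ih =>
    simp only [Expr.length] at hl
    have hv := e.natAbs_eval_le h hM he
    have := ih he (by omega) hv (bits_le (hv.trans (Nat.mul_le_mul_right _ (by omega))) hX)
    simp only [Expr.cost, Expr.length, add_mul, one_mul]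
    omega
  | add a b iha ihb =>
    simp only [Expr.unitLits, Bool.and_eq_true] at he
    simp only [Expr.length] at hl
    have hva := a.natAbs_eval_le h hM he.1
    have hvb := b.natAbs_eval_le h hM he.2
    have := iha he.1 (by omega) hva (bits_le (hva.trans (Nat.mul_le_mul_right _ (by omega))) hX)
    have := ihb he.2 (by omega) hvb (bits_le (hvb.trans (Nat.mul_le_mul_right _ (by omega))) hX)
    simp only [Expr.cost, Expr.length, add_mul, one_mul]
    omega
  | sub a b iha ihb =>
    simp only [Expr.unitLits, Bool.and_eq_true] at he
    simp only [Expr.length] at hl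
    have hva := a.natAbs_eval_le h hM he.1
    have hvb := b.natAbs_eval_le h hM he.2
    have := iha he.1 (by omega) hva (bits_le (hva.trans (Nat.mul_le_mul_right _ (by omega))) hX)
    have := ihb he.2 (by omega) hvb (bits_le (hvb.trans (Nat.mul_le_mul_right _ (by omega))) hX)
    simp only [Expr.cost, Expr.length, add_mul, one_mul]
    omega

theorem Expr.cost_le {M X : ℕ} {σ : State} (h : σ.Bdd M) (hM : 1 ≤ M) (hX : M ≤ X)
    {e : Expr} (he : e.short) : e.cost σ ≤ 8 * bits (8 * X) := by
  simp only [Expr.short, Bool.and_eq_true, decide_eq_true_eq] at he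
  exact (e.cost_le_length h hM hX he.1 he.2).trans (Nat.mul_le_mul_right _ he.2)

theorem bits_pos (z : ℤ) : 1 ≤ bits z := by simp [bits]

theorem Test.cost_le {M X : ℕ} {σ : State} (h : σ.Bdd M) (hM : 1 ≤ M) (hX : M ≤ X)
    {b : Test} (hb : b.short) : b.cost σ ≤ 25 * bits (8 * X) := by
  have := bits_pos (8 * X)
  cases b <;>
  · simp only [Test.short, Bool.and_eq_true] at hb
    have := Expr.cost_le h hM hX hb.1
    have := Expr.cost_le h hM hX hb.2
    simp only [Test.cost]
    omega

theorem Expr.natAbs_eval_le_of_flat {M : ℕ} {σ : State} (h : σ.Bdd M) (hM : 1 ≤ M) (e : Expr)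
    (he : e.flat) : (e.eval σ).natAbs ≤ M := by
  cases e with
  | lit z => simp [Expr.flat] at he; simp [Expr.eval]; omega
  | get x => exact h.reg x
  | rd f e => exact h.mem f _
  | add a b => simp [Expr.flat] at he
  | sub a b => simp [Expr.flat] at he

theorem Expr.natAbs_eval_le_of_mild {M : ℕ} {σ : State} (h : σ.Bdd M) (hM : 1 ≤ M) (e : Expr)
    (he : e.mild) : (e.eval σ).natAbs ≤ M + 1 := by
  unfold Expr.mild at he
  split at he
  · simp only [Bool.and_eq_true, decide_eq_true_eq] at he
    have := Expr.natAbs_eval_le_of_flat h hM _ he.1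
    simp only [Expr.eval]
    omega
  · simp only [Bool.and_eq_true, decide_eq_true_eq] at he
    have := Expr.natAbs_eval_le_of_flat h hM _ he.1
    simp only [Expr.eval]
    omega
  · exact (Expr.natAbs_eval_le_of_flat h hM _ he).trans (Nat.le_succ M)

/-- The unit-cost semantics. -/
inductive Steps (n : ℕ) : Stmt → State → State → ℕ → ℕ → Prop
  | skip {σ} : Steps n .skip σ σ 1 0
  | set {σ} (x) (e : Expr) (h : e.mild ∨ (e.eval σ).natAbs ≤ n) :
      Steps n (.set x e) σ (σ.setReg x (e.eval σ)) 1 0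
  | wr {σ} (f) (i e : Expr) (h : e.mild ∨ (e.eval σ).natAbs ≤ n) :
      Steps n (.wr f i e) σ (σ.write f (i.eval σ) (e.eval σ)) 1 0
  | emit {σ} (a b c) :
      Steps n (.emit a b c) σ (σ.emit (a.eval σ) (b.eval σ) (c.eval σ)) 1 0
  | seq {p q σ σ₁ σ₂ N₁ N₂ m₁ m₂} :
      Steps n p σ σ₁ N₁ m₁ → Steps n q σ₁ σ₂ N₂ m₂ → Steps n (.seq p q) σ σ₂ (N₁ + N₂) (m₁ + m₂)
  | cond_true {b p q σ σ' N m} :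
      b.holds σ → Steps n p σ σ' N m → Steps n (.cond b p q) σ σ' (1 + N) m
  | cond_false {b p q σ σ' N m} :
      ¬ b.holds σ → Steps n q σ σ' N m → Steps n (.cond b p q) σ σ' (1 + N) m
  | loop_true {b p σ σ₁ σ₂ N₁ N₂ m₁ m₂} :
      b.holds σ → Steps n p σ σ₁ N₁ m₁ → Steps n (.loop b p) σ₁ σ₂ N₂ m₂ →
      Steps n (.loop b p) σ σ₂ (1 + N₁ + N₂) (m₁ + m₂)
  | loop_false {b p σ} : ¬ b.holds σ → Steps n (.loop b p) σ σ 1 0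
  | call {f a b σ σ' N m} (ha : a.mild) (hb : b.mild) (hN : f = .sendAgent → N ≤ 40) :
      Steps n (code f) (σ.enter (a.eval σ) (b.eval σ)) σ' N m →
      Steps n (.call f a b) σ { σ' with reg := σ.reg } (1 + N)
        (m + if f = .sendAgent then 1 else 0)

theorem sendAgentTimes_append (L L' : List (Proc × ℕ)) :
    sendAgentTimes (L ++ L') = sendAgentTimes L ++ sendAgentTimes L' := by
  simp [sendAgentTimes]

/-- Logarithmic running times are bounded through the number of steps. -/
theorem Steps.exists_exec {n : ℕ} {p : Stmt} {σ σ' : State} {N m : ℕ} (h : Steps n p σ σ' N m) :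
    p.short → ∀ k M X : ℕ, σ.Bdd M → n ≤ M → 1 ≤ M → k ≤ M → M + N ≤ X →
      σ'.Bdd (M + N) ∧ ∃ t L, Exec code k p σ σ' t L ∧ t ≤ 25 * bits (8 * X) * N ∧
        (sendAgentTimes L).length = m ∧
        ∀ τ ∈ sendAgentTimes L, τ ≤ 25 * bits (8 * X) * 41 := by
  induction h with
  | skip =>
    intro _ k M X hσ _ _ _ hX
    have := bits_pos (8 * X)
    exact ⟨hσ.mono (by omega), _, _, .skip, by omega, rfl, by simp [sendAgentTimes]⟩
  | @set σ x e he =>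
    intro hp k M X hσ hn hM _ hX
    have := bits_pos (8 * X)
    have := Expr.cost_le hσ hM (X := X) (by omega) hp
    have hv : (e.eval σ).natAbs ≤ M + 1 :=
      he.elim (fun he => Expr.natAbs_eval_le_of_mild hσ hM e he) (by omega)
    exact ⟨(hσ.mono (by omega)).setReg hv _, _, _, .set _ _, by omega, rfl,
      by simp [sendAgentTimes]⟩
  | @wr σ f i e he =>
    intro hp k M X hσ hn hM _ hX
    simp only [Stmt.short, Bool.and_eq_true] at hp
    have := bits_pos (8 * X)
    have := Expr.cost_le hσ hM (X := X) (by omega) hp.1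
    have := Expr.cost_le hσ hM (X := X) (by omega) hp.2
    have hv : (e.eval σ).natAbs ≤ M + 1 :=
      he.elim (fun he => Expr.natAbs_eval_le_of_mild hσ hM e he) (by omega)
    exact ⟨(hσ.mono (by omega)).write hv _ _, _, _, .wr _ _ _, by omega, rfl,
      by simp [sendAgentTimes]⟩
  -- Three expressions of eight nodes each and the step itself: this case fixes the constant 25.
  | emit a b c =>
    intro hp k M X hσ hn hM _ hX
    simp only [Stmt.short, Bool.and_eq_true] at hp
    have := bits_pos (8 * X)
    have := Expr.cost_le hσ hM (X := X) (by omega) hp.1.1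
    have := Expr.cost_le hσ hM (X := X) (by omega) hp.1.2
    have := Expr.cost_le hσ hM (X := X) (by omega) hp.2
    exact ⟨⟨(hσ.mono (by omega)).reg, (hσ.mono (by omega)).mem⟩, _, _, .emit _ _ _, by omega, rfl,
      by simp [sendAgentTimes]⟩
  | @seq p q σ σ₁ σ₂ N₁ N₂ m₁ m₂ _ _ ih₁ ih₂ =>
    intro hp k M X hσ hn hM hk hX
    simp only [Stmt.short, Bool.and_eq_true] at hp
    obtain ⟨h₁, t₁, L₁, e₁, ht₁, hL₁, hτ₁⟩ := ih₁ hp.1 k M X hσ hn hM hk (by omega)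
    obtain ⟨h₂, t₂, L₂, e₂, ht₂, hL₂, hτ₂⟩ :=
      ih₂ hp.2 k (M + N₁) X h₁ (by omega) (by omega) (by omega) (by omega)
    refine ⟨h₂.mono (by omega), _, _, .seq e₁ e₂, by rw [mul_add]; omega, ?_, ?_⟩
    · simp [sendAgentTimes_append, hL₁, hL₂]
    · intro τ hτ
      rw [sendAgentTimes_append, List.mem_append] at hτ
      exact hτ.elim (hτ₁ τ) (hτ₂ τ)
  | cond_true hb _ ih =>
    intro hp k M X hσ hn hM hk hX
    simp only [Stmt.short, Bool.and_eq_true] at hp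
    obtain ⟨h₁, t₁, L₁, e₁, ht₁, hL₁, hτ₁⟩ := ih hp.1.2 k M X hσ hn hM hk (by omega)
    have := Test.cost_le hσ hM (X := X) (by omega) hp.1.1
    exact ⟨h₁.mono (by omega), _, _, .cond_true hb e₁, by rw [mul_add]; omega, hL₁, hτ₁⟩
  | cond_false hb _ ih =>
    intro hp k M X hσ hn hM hk hX
    simp only [Stmt.short, Bool.and_eq_true] at hp
    obtain ⟨h₁, t₁, L₁, e₁, ht₁, hL₁, hτ₁⟩ := ih hp.2 k M X hσ hn hM hk (by omega)
    have := Test.cost_le hσ hM (X := X) (by omega) hp.1.1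
    exact ⟨h₁.mono (by omega), _, _, .cond_false hb e₁, by rw [mul_add]; omega, hL₁, hτ₁⟩
  | @loop_true b p σ σ₁ σ₂ N₁ N₂ m₁ m₂ hb _ _ ih₁ ih₂ =>
    intro hp k M X hσ hn hM hk hX
    have hp' := hp
    simp only [Stmt.short, Bool.and_eq_true] at hp
    obtain ⟨h₁, t₁, L₁, e₁, ht₁, hL₁, hτ₁⟩ := ih₁ hp.2 k M X hσ hn hM hk (by omega)
    obtain ⟨h₂, t₂, L₂, e₂, ht₂, hL₂, hτ₂⟩ :=
      ih₂ hp' k (M + N₁) X h₁ (by omega) (by omega) (by omega) (by omega)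
    have := Test.cost_le hσ hM (X := X) (by omega) hp.1
    refine ⟨h₂.mono (by omega), _, _, .loop_true hb e₁ e₂, by rw [mul_add, mul_add]; omega, ?_, ?_⟩
    · simp [sendAgentTimes_append, hL₁, hL₂]
    · intro τ hτ
      rw [sendAgentTimes_append, List.mem_append] at hτ
      exact hτ.elim (hτ₁ τ) (hτ₂ τ)
  | loop_false hb =>
    intro hp k M X hσ hn hM hk hX
    simp only [Stmt.short, Bool.and_eq_true] at hp
    have := Test.cost_le hσ hM (X := X) (by omega) hp.1
    exact ⟨hσ.mono (by omega), _, _, .loop_false hb, by omega, rfl, by simp [sendAgentTimes]⟩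
  | @call f a b σ σ' N m ha hb hN _ ih =>
    intro hp k M X hσ hn hM hk hX
    simp only [Stmt.short, Bool.and_eq_true] at hp
    have := Expr.natAbs_eval_le_of_mild hσ hM a ha
    have := Expr.natAbs_eval_le_of_mild hσ hM b hb
    -- The one step charged for the call pays both for the mild arguments and for the larger depth:
    -- all are at most `M + 1`.
    obtain ⟨h₁, t₁, L₁, e₁, ht₁, hL₁, hτ₁⟩ := ih (code_short f) (k + 1) (M + 1) X
      ((hσ.mono (by omega)).enter (by omega) (by omega)) (by omega) (by omega) (by omega) (by omega)
    have hreg : ∀ x, bits (σ.reg x) ≤ bits (8 * X) := fun x =>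
      bits_le (M := M) ((hσ.reg x).trans (by omega)) (by omega)
    have hcost : callCost k σ a b ≤ 25 * bits (8 * X) := by
      have := Expr.cost_le hσ hM (X := X) (by omega) hp.1
      have := Expr.cost_le hσ hM (X := X) (by omega) hp.2
      have : bits k ≤ bits (8 * X) := bits_mono (by omega)
      have := hreg .u
      have := hreg .v
      have := hreg .w
      have := hreg .t
      have := hreg .c
      have := hreg .n
      unfold callCost
      omega
    have htime : callCost k σ a b + t₁ ≤ 25 * bits (8 * X) * (1 + N) := by
      rw [mul_add]
      omega
    refine ⟨⟨fun x => (hσ.reg x).trans (by omega), (h₁.mono (by omega)).mem⟩, _, _, .call e₁,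
      htime, ?_, ?_⟩
    · by_cases hf : f = .sendAgent
      · simp [sendAgentTimes, hf] at hL₁ ⊢
        exact hL₁
      · simp [sendAgentTimes, hf] at hL₁ ⊢
        exact hL₁
    · intro τ hτ
      by_cases hf : f = .sendAgent
      · have : sendAgentTimes ((f, callCost k σ a b + t₁) :: L₁) =
            (callCost k σ a b + t₁) :: sendAgentTimes L₁ := by simp [sendAgentTimes, hf]
        rw [this, List.mem_cons] at hτ
        rcases hτ with rfl | hτ
        -- Here 41 is the call itself plus the at most 40 steps of the body.
        · exact htime.trans (Nat.mul_le_mul_left _ (by have := hN hf; omega))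
        · exact hτ₁ τ hτ
      · have : sendAgentTimes ((f, callCost k σ a b + t₁) :: L₁) = sendAgentTimes L₁ := by
          simp [sendAgentTimes, hf]
        exact hτ₁ τ (this ▸ hτ)

/-! ## Reasoning about programs -/

/-- `p` started in `σ` terminates, and `Q` holds for the final state, the number of steps and the
number of calls to `send_agent`. -/
def Runs (n : ℕ) (p : Stmt) (σ : State) (Q : State → ℕ → ℕ → Prop) : Prop :=
  ∃ σ' N m, Steps n p σ σ' N m ∧ Q σ' N m

variable {n : ℕ} {σ : State} {Q : State → ℕ → ℕ → Prop}

theorem Runs.mono {p : Stmt} {P : State → ℕ → ℕ → Prop} (h : Runs n p σ P)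
    (hPQ : ∀ σ' N m, P σ' N m → Q σ' N m) : Runs n p σ Q :=
  let ⟨σ', N, m, h, hP⟩ := h
  ⟨σ', N, m, h, hPQ _ _ _ hP⟩

/-- This and the following equivalences are a weakest-precondition calculus: rewriting with them
turns a claim about straight-line code into conditions on values. -/
theorem runs_skip : Runs n .skip σ Q ↔ Q σ 1 0 :=
  ⟨fun ⟨_, _, _, h, hQ⟩ => by cases h; exact hQ, fun h => ⟨_, _, _, .skip, h⟩⟩

theorem runs_set {x : Reg} {e : Expr} : Runs n (.set x e) σ Q ↔
    (e.mild ∨ (e.eval σ).natAbs ≤ n) ∧ Q (σ.setReg x (e.eval σ)) 1 0 :=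
  ⟨fun ⟨_, _, _, h, hQ⟩ => by cases h with | set _ _ h => exact ⟨h, hQ⟩,
    fun h => ⟨_, _, _, .set _ _ h.1, h.2⟩⟩

theorem runs_wr {f : Field} {i e : Expr} : Runs n (.wr f i e) σ Q ↔
    (e.mild ∨ (e.eval σ).natAbs ≤ n) ∧ Q (σ.write f (i.eval σ) (e.eval σ)) 1 0 :=
  ⟨fun ⟨_, _, _, h, hQ⟩ => by cases h with | wr _ _ _ h => exact ⟨h, hQ⟩,
    fun h => ⟨_, _, _, .wr _ _ _ h.1, h.2⟩⟩

theorem runs_emit {a b c : Expr} : Runs n (.emit a b c) σ Q ↔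
    Q (σ.emit (a.eval σ) (b.eval σ) (c.eval σ)) 1 0 :=
  ⟨fun ⟨_, _, _, h, hQ⟩ => by cases h; exact hQ, fun h => ⟨_, _, _, .emit _ _ _, h⟩⟩

theorem runs_seq {p q : Stmt} : Runs n (.seq p q) σ Q ↔
    Runs n p σ fun σ₁ N₁ m₁ => Runs n q σ₁ fun σ₂ N₂ m₂ => Q σ₂ (N₁ + N₂) (m₁ + m₂) :=
  ⟨fun ⟨_, _, _, h, hQ⟩ => by cases h with | seq h₁ h₂ => exact ⟨_, _, _, h₁, _, _, _, h₂, hQ⟩,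
    fun ⟨_, _, _, h₁, _, _, _, h₂, hQ⟩ => ⟨_, _, _, .seq h₁ h₂, hQ⟩⟩

theorem runs_cond {b : Test} {p q : Stmt} : Runs n (.cond b p q) σ Q ↔
    (b.holds σ → Runs n p σ fun σ' N m => Q σ' (1 + N) m) ∧
    (¬ b.holds σ → Runs n q σ fun σ' N m => Q σ' (1 + N) m) := by
  constructor
  · rintro ⟨_, _, _, h, hQ⟩
    cases h with
    | cond_true hb h => exact ⟨fun _ => ⟨_, _, _, h, hQ⟩, fun hn => absurd hb hn⟩
    | cond_false hb h => exact ⟨fun hn => absurd hn hb, fun _ => ⟨_, _, _, h, hQ⟩⟩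
  · rintro ⟨h₁, h₂⟩
    by_cases hb : b.holds σ
    · obtain ⟨_, _, _, h, hQ⟩ := h₁ hb
      exact ⟨_, _, _, .cond_true hb h, hQ⟩
    · obtain ⟨_, _, _, h, hQ⟩ := h₂ hb
      exact ⟨_, _, _, .cond_false hb h, hQ⟩

/-- The caller continues with its own registers and the memory of the callee. Requiring `Q` for all
such states makes specifications independent of the output. -/
theorem runs_call {f : Proc} {a b : Expr} (ha : a.mild) (hb : b.mild)
    (h : Runs n (code f) (σ.enter (a.eval σ) (b.eval σ)) fun σ' N m =>
      (f = .sendAgent → N ≤ 40) ∧ ∀ τ : State, τ.reg = σ.reg → τ.mem = σ'.mem →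
        Q τ (1 + N) (m + if f = .sendAgent then 1 else 0)) :
    Runs n (.call f a b) σ Q :=
  let ⟨_, _, _, h, hN, hQ⟩ := h
  ⟨_, _, _, .call ha hb hN h, hQ _ rfl rfl⟩

/-- The rule for loops that run through a list. -/
theorem runs_loop_list {α : Type*} {b : Test} {p : Stmt} (I : List α → State → Prop)
    (cost count : α → ℕ) (hnil : ∀ σ, I [] σ → ¬ b.holds σ)
    (hcons : ∀ y ys σ, I (y :: ys) σ → b.holds σ ∧
      Runs n p σ fun σ' N m => I ys σ' ∧ N ≤ cost y ∧ m = count y)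
    (ys : List α) (hI : I ys σ) :
    Runs n (.loop b p) σ fun σ' N m =>
      I [] σ' ∧ N ≤ (ys.map fun y => cost y + 1).sum + 1 ∧ m = (ys.map count).sum := by
  induction ys generalizing σ with
  | nil => exact ⟨_, _, _, .loop_false (hnil σ hI), hI, by simp, by simp⟩
  | cons y ys ih =>
    obtain ⟨hb, σ₁, N₁, m₁, h₁, hI₁, hN₁, hm₁⟩ := hcons y ys σ hI
    obtain ⟨σ₂, N₂, m₂, h₂, hI₂, hN₂, hm₂⟩ := ih hI₁
    refine ⟨_, _, _, .loop_true hb h₁ h₂, hI₂, ?_, ?_⟩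
    · simp only [List.map_cons, List.sum_cons]
      omega
    · simp [hm₁, hm₂]

end RAM

/-! ## Rooted trees given by their parent map -/

namespace UPMT

open Finset

/-- A tree on `Fin n`, given by the parents of its nodes. -/
structure ParentMap (n : ℕ) where
  par : Fin n → Fin n
  root : Fin n
  depth : Fin n → ℕ
  par_root : par root = root
  depth_par : ∀ v, v ≠ root → depth (par v) < depth v

namespace ParentMap

variable {n : ℕ} (t : ParentMap n)

/-- The children of a node. -/
def children (u : Fin n) : List (Fin n) :=
  -- Reversed because the program visits the nodes in increasing order and inserts each at the front
  -- of the list of its parent.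
  ((List.finRange n).filter fun c => c ≠ t.root ∧ t.par c = u).reverse

open Classical in
/-- The nodes of the subtree of `u`. -/
noncomputable def subtree (u : Fin n) : Finset (Fin n) :=
  univ.filter fun v => ∃ m, t.par^[m] v = u

variable {t}

theorem mem_children {u c : Fin n} : c ∈ t.children u ↔ c ≠ t.root ∧ t.par c = u := by
  simp [children]

theorem nodup_children (u : Fin n) : (t.children u).Nodup :=
  List.nodup_reverse.2 ((List.nodup_finRange n).filter _)

theorem mem_subtree {u v : Fin n} : v ∈ t.subtree u ↔ ∃ m, t.par^[m] v = u := by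
  simp [subtree]

theorem self_mem_subtree (u : Fin n) : u ∈ t.subtree u := mem_subtree.2 ⟨0, rfl⟩

theorem depth_par_le (v : Fin n) : t.depth (t.par v) ≤ t.depth v := by
  by_cases h : v = t.root
  · rw [h, t.par_root]
  · exact (t.depth_par v h).le

theorem depth_le_of_mem_subtree {u v : Fin n} (h : v ∈ t.subtree u) : t.depth u ≤ t.depth v := by
  obtain ⟨m, rfl⟩ := mem_subtree.1 h
  induction m with
  | zero => exact le_rfl
  | succ m ih =>
    rw [Function.iterate_succ_apply']
    exact (depth_par_le _).trans (ih (mem_subtree.2 ⟨m, rfl⟩))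

theorem depth_lt_of_mem_children {u c : Fin n} (h : c ∈ t.children u) : t.depth u < t.depth c := by
  rw [mem_children] at h
  rw [← h.2]
  exact t.depth_par c h.1

theorem not_mem_subtree_of_mem_children {u c : Fin n} (h : c ∈ t.children u) :
    u ∉ t.subtree c := fun hu =>
  (depth_lt_of_mem_children h).not_ge (depth_le_of_mem_subtree hu)

theorem mem_subtree_iff {u v : Fin n} :
    v ∈ t.subtree u ↔ v = u ∨ ∃ c ∈ t.children u, v ∈ t.subtree c := by
  constructor
  · intro h
    obtain ⟨m, hm⟩ := mem_subtree.1 h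
    induction m with
    | zero => exact .inl hm
    | succ m ih =>
      rw [Function.iterate_succ_apply'] at hm
      by_cases hc : t.par^[m] v = t.root
      · rw [hc, t.par_root, ← hc] at hm
        exact ih hm
      · exact .inr ⟨_, mem_children.2 ⟨hc, hm⟩, mem_subtree.2 ⟨m, rfl⟩⟩
  · rintro (rfl | ⟨c, hc, hv⟩)
    · exact self_mem_subtree _
    · obtain ⟨m, rfl⟩ := mem_subtree.1 hv
      exact mem_subtree.2 ⟨m + 1, by rw [Function.iterate_succ_apply', (mem_children.1 hc).2]⟩

theorem mem_subtree_of_mem_children {u c v : Fin n} (hc : c ∈ t.children u)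
    (hv : v ∈ t.subtree c) : v ∈ t.subtree u :=
  mem_subtree_iff.2 (.inr ⟨c, hc, hv⟩)

theorem mem_subtree_trans {u v w : Fin n} (h : u ∈ t.subtree v) (h' : v ∈ t.subtree w) :
    u ∈ t.subtree w := by
  obtain ⟨m, rfl⟩ := mem_subtree.1 h
  obtain ⟨m', rfl⟩ := mem_subtree.1 h'
  exact mem_subtree.2 ⟨m' + m, Function.iterate_add_apply _ _ _ _⟩

theorem child_mem_subtree {u c : Fin n} (hc : c ∈ t.children u) : c ∈ t.subtree u :=
  mem_subtree_of_mem_children hc (self_mem_subtree c)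

/-- Of two ancestors of `v`, one is an iterated parent of the other. If at least one step separated
two children of `u`, the first step would lead to `u`, and `u` would lie below its own child. -/
theorem eq_of_mem_subtree_children {u c c' v : Fin n} (hc : c ∈ t.children u)
    (hc' : c' ∈ t.children u) (hv : v ∈ t.subtree c) (hv' : v ∈ t.subtree c') : c = c' := by
  have key : ∀ {c c' : Fin n} {m j : ℕ}, c ∈ t.children u → c' ∈ t.children u →
      t.par^[m] v = c → t.par^[j + m] v = c' → c = c' := by
    intro c c' m j hc hc' h h'
    rw [Function.iterate_add_apply, h] at h'
    cases j with
    | zero => exact h'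
    | succ j =>
      rw [Function.iterate_succ_apply, (mem_children.1 hc).2] at h'
      exact absurd (mem_subtree.2 ⟨j, h'⟩) (not_mem_subtree_of_mem_children hc')
  obtain ⟨m, hm⟩ := mem_subtree.1 hv
  obtain ⟨m', hm'⟩ := mem_subtree.1 hv'
  rcases le_total m m' with h | h
  · exact key hc hc' hm (by rwa [Nat.sub_add_cancel h] : t.par^[(m' - m) + m] v = c')
  · exact (key hc' hc hm' (by rwa [Nat.sub_add_cancel h] : t.par^[(m - m') + m'] v = c)).symm

theorem subtree_root : t.subtree t.root = univ := by
  refine eq_univ_of_forall fun v => ?_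
  induction h : t.depth v using Nat.strong_induction_on generalizing v with
  | _ k ih =>
    by_cases hv : v = t.root
    · rw [hv]
      exact self_mem_subtree _
    · obtain ⟨m, hm⟩ := mem_subtree.1 (ih _ (h ▸ t.depth_par v hv) (t.par v) rfl)
      exact mem_subtree.2 ⟨m + 1, by rwa [Function.iterate_succ_apply]⟩

/-- Sums over a subtree are computed recursively. -/
theorem sum_subtree {M : Type*} [AddCommMonoid M] (f : Fin n → M) (u : Fin n) :
    ∑ v ∈ t.subtree u, f v = f u + ((t.children u).map fun c => ∑ v ∈ t.subtree c, f v).sum := by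
  have h : t.subtree u = insert u ((t.children u).toFinset.biUnion t.subtree) := by
    ext v
    rw [mem_subtree_iff]
    simp
  rw [h, sum_insert, sum_biUnion, List.sum_toFinset _ (nodup_children u)]
  · intro c hc c' hc' hne
    rw [Function.onFun, disjoint_left]
    exact fun v hv hv' => hne (eq_of_mem_subtree_children (by simpa using hc) (by simpa using hc')
      hv hv')
  · simp only [mem_biUnion, List.mem_toFinset, not_exists, not_and]
    exact fun c hc => not_mem_subtree_of_mem_children hc

/-- Induction from the leaves to the root. -/
theorem induction_children {P : Fin n → Prop} (h : ∀ u, (∀ c ∈ t.children u, P c) → P u)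
    (u : Fin n) : P u := by
  obtain ⟨b, hb⟩ : ∃ b, ∀ v, t.depth v ≤ b :=
    ⟨univ.sup t.depth, fun v => le_sup (f := t.depth) (mem_univ v)⟩
  induction hk : b - t.depth u using Nat.strong_induction_on generalizing u with
  | _ k ih =>
    refine h u fun c hc => ih _ ?_ c rfl
    have := depth_lt_of_mem_children hc
    have := hb c
    omega

end ParentMap

end UPMT

/-! ## The optimal number of moves -/

namespace UPMT

open Finset

namespace ParentMap

variable {n : ℕ} {t : ParentMap n}

theorem sum_map_children {M : Type*} [AddCommMonoid M] (f : Fin n → M) (u : Fin n) :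
    ((t.children u).map f).sum = ∑ c, if c ≠ t.root ∧ t.par c = u then f c else 0 := by
  rw [← List.sum_toFinset _ (nodup_children u), ← sum_filter]
  congr 1
  ext c
  simp [mem_children]

/-- Each non-root node is a child of exactly one node, so the double sum is a sum over edges. -/
theorem sum_mul_sum_map_children (f g : Fin n → ℤ) :
    ∑ u, g u * ((t.children u).map f).sum = ∑ c, if c ≠ t.root then g (t.par c) * f c else 0 := by
  simp_rw [sum_map_children, mul_sum]
  rw [sum_comm]
  refine sum_congr rfl fun c _ => ?_
  by_cases hc : c = t.root <;> simp [hc]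

/-- The demand of the subtree of `u` when the nodes of `P` carry the pebbles. -/
noncomputable def demand (t : ParentMap n) (B P : Finset (Fin n)) (u : Fin n) : ℤ :=
  ∑ v ∈ t.subtree u, ((if v ∈ B then 1 else 0) - if v ∈ P then 1 else 0)

variable {B P : Finset (Fin n)}

theorem demand_eq (u : Fin n) : t.demand B P u =
    (if u ∈ B then 1 else 0) - (if u ∈ P then 1 else 0) +
      ((t.children u).map (t.demand B P)).sum :=
  sum_subtree _ u

theorem demand_self (u : Fin n) : t.demand B B u = 0 := by simp [demand]

theorem demand_root (h : P.card = B.card) : t.demand B P t.root = 0 := by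
  simp [demand, subtree_root, h]

theorem natAbs_demand_le (u : Fin n) : (t.demand B P u).natAbs ≤ n := by
  refine (Int.natAbs_sum_le _ _).trans ?_
  refine (sum_le_card_nsmul _ _ 1 fun v _ => ?_).trans ?_
  · split_ifs <;> simp
  · simpa using card_le_univ (t.subtree u)

theorem demand_move {x y : Fin n} (hx : x ∈ P) (hy : y ∉ P) (w : Fin n) :
    t.demand B (insert y (P.erase x)) w = t.demand B P w +
      (if x ∈ t.subtree w then 1 else 0) - if y ∈ t.subtree w then 1 else 0 := by
  have hind : ∀ v, ((if v ∈ B then 1 else 0) - if v ∈ insert y (P.erase x) then 1 else 0 : ℤ) =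
      ((if v ∈ B then 1 else 0) - if v ∈ P then 1 else 0) + (if v = x then 1 else 0) -
        if v = y then 1 else 0 := by
    intro v
    simp only [mem_insert, mem_erase]
    grind
  simp only [demand, hind, sum_sub_distrib, sum_add_distrib, sum_ite_eq']

/-- The subtree of `v` is the only one that separates `v` from its parent. This is why a move along
that edge changes no demand other than that of `v`. -/
theorem mem_subtree_par {v w : Fin n} (hv : v ≠ t.root) :
    v ∈ t.subtree w ↔ w = v ∨ t.par v ∈ t.subtree w := by
  constructor
  · intro h
    obtain ⟨m, hm⟩ := mem_subtree.1 h
    cases m with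
    | zero => exact .inl hm.symm
    | succ m => exact .inr (mem_subtree.2 ⟨m, hm⟩)
  · rintro (rfl | h)
    · exact self_mem_subtree _
    · exact mem_subtree_trans (child_mem_subtree (mem_children.2 ⟨hv, rfl⟩)) h

theorem par_not_mem_subtree {v : Fin n} (hv : v ≠ t.root) : t.par v ∉ t.subtree v :=
  not_mem_subtree_of_mem_children (mem_children.2 ⟨hv, rfl⟩)

theorem demand_move_up {v : Fin n} (hv : v ≠ t.root) (hx : v ∈ P) (hy : t.par v ∉ P) :
    t.demand B (insert (t.par v) (P.erase v)) =
      Function.update (t.demand B P) v (t.demand B P v + 1) := by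
  funext w
  simp only [demand_move hx hy, mem_subtree_par hv]
  by_cases hw : w = v
  · subst hw
    simp [par_not_mem_subtree hv]
  · simp [hw]

theorem demand_move_down {v : Fin n} (hv : v ≠ t.root) (hx : t.par v ∈ P) (hy : v ∉ P) :
    t.demand B (insert v (P.erase (t.par v))) =
      Function.update (t.demand B P) v (t.demand B P v - 1) := by
  funext w
  simp only [demand_move hx hy, mem_subtree_par hv]
  by_cases hw : w = v
  · subst hw
    simp [par_not_mem_subtree hv]
  · simp [hw]

/-- The sum of the absolute values of all demands. -/
noncomputable def imbalance (t : ParentMap n) (B P : Finset (Fin n)) : ℕ :=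
  ∑ u, (t.demand B P u).natAbs

theorem imbalance_le_of_demand_eq_update {P' : Finset (Fin n)} {v : Fin n} {z : ℤ}
    (h : t.demand B P' = Function.update (t.demand B P) v z) :
    t.imbalance B P' + (t.demand B P v).natAbs = t.imbalance B P + z.natAbs := by
  rw [imbalance, imbalance, h, ← add_sum_erase _ _ (mem_univ v),
    ← add_sum_erase univ (fun u => (t.demand B P u).natAbs) (mem_univ v)]
  have : ∑ x ∈ univ.erase v, (Function.update (t.demand B P) v z x).natAbs =
      ∑ x ∈ univ.erase v, (t.demand B P x).natAbs :=
    sum_congr rfl fun x hx => by rw [Function.update_of_ne (ne_of_mem_erase hx)]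
  rw [this, Function.update_self]
  omega

/-- As long as some pebble is not on a target, some move along an edge decreases the imbalance. -/
theorem exists_move (hcard : P.card = B.card) (hne : P ≠ B) :
    ∃ v, v ≠ t.root ∧ ((t.demand B P v < 0 ∧ v ∈ P ∧ t.par v ∉ P) ∨
      (0 < t.demand B P v ∧ t.par v ∈ P ∧ v ∉ P)) := by
  by_contra! hno
  -- With equal cardinalities inclusion would give equality, so some pebble `x` is off target; it
  -- makes the sum below negative.
  refine hne (eq_of_subset_of_card_le (fun x hx => ?_) hcard.ge)
  by_contra hxB
  let ind : Fin n → ℤ := fun v => if v ∈ P then 1 else 0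
  have h₁ : ∑ u, ind u * ((if u ∈ B then 1 else 0) - ind u) =
      ∑ u, ind u * t.demand B P u - ∑ u, ind u * ((t.children u).map (t.demand B P)).sum := by
    rw [← sum_sub_distrib]
    refine sum_congr rfl fun u _ => ?_
    rw [← mul_sub]
    nth_rw 1 [demand_eq u]
    simp [ind]
  -- Rewritten over edges, the summand of `c` is `(ind c - ind (par c)) * demand c`. It vanishes
  -- unless exactly one end carries a pebble, and then its sign is the one left by the absence of an
  -- improving move.
  have h₂ : 0 ≤ ∑ u, ind u * ((if u ∈ B then 1 else 0) - ind u) := by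
    rw [h₁, sum_mul_sum_map_children, ← sum_sub_distrib]
    refine sum_nonneg fun c _ => ?_
    by_cases hc : c = t.root
    · simp [hc, demand_root hcard]
    · have := hno c hc
      by_cases h : c ∈ P <;> by_cases h' : t.par c ∈ P <;> simp [ind, hc, h, h']
      · by_contra hlt
        exact h' (this.1 (by omega) h)
      · by_contra hlt
        exact h (this.2 (by omega) h')
  have h₃ : ∑ u, ind u * ((if u ∈ B then 1 else 0) - ind u) < 0 := by
    refine (sum_lt_sum (f := fun u => ind u * ((if u ∈ B then 1 else 0) - ind u)) (g := 0)
      (fun u _ => ?_) ⟨x, mem_univ _, ?_⟩).trans_eq (by simp)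
    · by_cases h : u ∈ P <;> by_cases h' : u ∈ B <;> simp [ind, h, h']
    · simp [ind, hx, hxB]
  exact h₂.not_gt h₃

/-- `t` describes the tree `T`. -/
def Describes (t : ParentMap n) (T : SimpleGraph (Fin n)) : Prop :=
  ∀ x y, T.Adj x y ↔ (x ≠ t.root ∧ t.par x = y) ∨ (y ≠ t.root ∧ t.par y = x)

variable {T : SimpleGraph (Fin n)}

theorem card_move {x y : Fin n} (hx : x ∈ P) (hy : y ∉ P) :
    (insert y (P.erase x)).card = P.card := by
  rw [card_insert_of_notMem (fun h => hy (mem_of_mem_erase h)), card_erase_add_one hx]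

/-- The lower bound: a move changes one demand by one and hence the imbalance by at most one. -/
theorem imbalance_le_length (ht : t.Describes T) {ms : List (Fin n × Fin n)} {Q : Finset (Fin n)}
    (h : IsPlan T P ms Q) :
    P.card = Q.card ∧ t.imbalance B P ≤ t.imbalance B Q + ms.length := by
  induction ms generalizing P with
  | nil => cases h; simp
  | cons m ms ih =>
    obtain ⟨x, y⟩ := m
    obtain ⟨hx, hy, hadj, h⟩ := h
    obtain ⟨hc, hi⟩ := ih h
    rw [card_move hx hy] at hc
    refine ⟨hc, ?_⟩
    rw [List.length_cons]
    rcases (ht x y).1 hadj with ⟨hr, rfl⟩ | ⟨hr, rfl⟩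
    · have := imbalance_le_of_demand_eq_update (demand_move_up (B := B) hr hx hy)
      omega
    · have := imbalance_le_of_demand_eq_update (demand_move_down (B := B) hr hx hy)
      omega

theorem imbalance_self : t.imbalance B B = 0 := by simp [imbalance, demand_self]

/-- The greedy plan: each move from `exists_move` lowers the imbalance by one. At imbalance zero
such a move would need a nonzero demand, so all pebbles are on targets. -/
theorem exists_plan (ht : t.Describes T) (hcard : P.card = B.card) :
    ∃ ms : List (Fin n × Fin n), IsPlan T P ms B ∧ ms.length = t.imbalance B P := by
  induction hk : t.imbalance B P generalizing P with
  | zero =>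
    by_cases hne : P = B
    · exact ⟨[], hne, rfl⟩
    · obtain ⟨v, _, h⟩ := exists_move (t := t) hcard hne
      have := (sum_eq_zero_iff_of_nonneg (fun _ _ => Nat.zero_le _)).1 hk v (mem_univ v)
      omega
  | succ k ih =>
    have hne : P ≠ B := by
      rintro rfl
      simp [imbalance_self] at hk
    obtain ⟨v, hv, ⟨hd, hx, hy⟩ | ⟨hd, hx, hy⟩⟩ := exists_move (t := t) hcard hne
    · have := imbalance_le_of_demand_eq_update (demand_move_up (B := B) hv hx hy)
      obtain ⟨ms, hms, hl⟩ := ih ((card_move hx hy).trans hcard) (by omega)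
      exact ⟨(v, t.par v) :: ms, ⟨hx, hy, (ht _ _).2 (.inl ⟨hv, rfl⟩), hms⟩, by simp [hl]⟩
    · have := imbalance_le_of_demand_eq_update (demand_move_down (B := B) hv hx hy)
      obtain ⟨ms, hms, hl⟩ := ih ((card_move hx hy).trans hcard) (by omega)
      exact ⟨(t.par v, v) :: ms, ⟨hx, hy, (ht _ _).2 (.inr ⟨hv, rfl⟩), hms⟩, by simp [hl]⟩

theorem OPT_eq_imbalance (ht : t.Describes T) (hcard : P.card = B.card) :
    OPT T P B = t.imbalance B P := by
  refine IsLeast.csInf_eq ⟨?_, ?_⟩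
  · obtain ⟨ms, h, hl⟩ := exists_plan ht hcard
    exact ⟨ms, ⟨B, h, Subset.rfl⟩, hl⟩
  · rintro m ⟨ms, ⟨Q, h, hQ⟩, rfl⟩
    obtain ⟨hc, hi⟩ := imbalance_le_length (B := B) ht h
    -- Moves preserve the number of pebbles, so the pebbles end up filling all of `B`.
    obtain rfl := eq_of_subset_of_card_le hQ (by omega)
    simpa [imbalance_self] using hi

/-- This polynomial bound makes the logarithm of the number of steps comparable to `log n`. -/
theorem imbalance_le : t.imbalance B P ≤ n * n :=
  (sum_le_card_nsmul _ _ n fun u _ => natAbs_demand_le u).trans (by simp)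

end ParentMap

/-! ### The parent map of a rooted tree -/

section Tree

variable {n : ℕ} {T : SimpleGraph (Fin n)} (hT : T.IsTree) (r : Fin n)

theorem parent_eq_snd {u : Fin n} {p : T.Walk u r} (hp : p.IsPath) : parent hT r u = p.snd := by
  have h := hT.existsUnique_path u r
  rw [parent, h.unique h.choose_spec.1 hp]

/-- The parent map of the tree `T` rooted at `r`. -/
noncomputable def parentMap : ParentMap n where
  par := parent hT r
  root := r
  depth u := (hT.existsUnique_path u r).choose.length
  par_root := parent_eq_snd hT r (p := .nil) (by simp)
  depth_par v hv := by
    have h := (hT.existsUnique_path v r).choose_spec.1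
    unfold parent
    generalize (hT.existsUnique_path v r).choose = p at h ⊢
    cases p with
    | nil => exact absurd rfl hv
    | cons hadj p =>
      rw [SimpleGraph.Walk.cons_isPath_iff] at h
      have hlen : ∀ (x : Fin n) (q : T.Walk x r), q.IsPath →
          (hT.existsUnique_path x r).choose.length = q.length := fun x q hq => by
        rw [(hT.existsUnique_path x r).unique (hT.existsUnique_path x r).choose_spec.1 hq]
      rw [SimpleGraph.Walk.snd_cons]
      exact (hlen _ p h.1).trans_lt (Nat.lt_succ_self _)

/-- For an edge `xy`, look at the path from `x` to the root. If it contains `y`, acyclicity makes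
`y` its second node; otherwise prefixing the edge gives the path from `y`, whose second node is `x`.
-/
theorem describes_parentMap : (parentMap hT r).Describes T := by
  have hpar : ∀ x, x ≠ r → T.Adj x (parent hT r x) := by
    intro x hx
    have h := (hT.existsUnique_path x r).choose_spec.1
    rw [parent_eq_snd hT r h]
    exact SimpleGraph.Walk.adj_snd (SimpleGraph.Walk.not_nil_of_ne hx)
  intro x y
  constructor
  · intro hadj
    have h := (hT.existsUnique_path x r).choose_spec.1
    by_cases hy : y ∈ (hT.existsUnique_path x r).choose.support
    · refine .inl ⟨?_, ?_⟩
      · rintro rfl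
        have hp := (hT.existsUnique_path x x).unique h (y₂ := .nil) (by simp)
        rw [hp] at hy
        simp at hy
        exact hadj.ne hy.symm
      · exact (parent_eq_snd hT r h).trans (hT.isAcyclic.eq_snd_of_adj_start h hadj hy).symm
    · refine .inr ⟨?_, ?_⟩
      · rintro rfl
        exact hy (SimpleGraph.Walk.end_mem_support _)
      · exact (parent_eq_snd hT r
          ((SimpleGraph.Walk.cons_isPath_iff hadj.symm _).2 ⟨h, hy⟩)).trans (by simp)
  · rintro (⟨hx, rfl⟩ | ⟨hy, rfl⟩)
    exacts [hpar x hx, (hpar y hy).symm]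

end Tree

end UPMT

/-! ## Linked lists -/

namespace RAM

open UPMT

@[simp] theorem State.setReg_reg (σ : State) (x : Reg) (z : ℤ) :
    (σ.setReg x z).reg = Function.update σ.reg x z := by
  funext y
  simp [State.setReg, Function.update_apply]

@[simp] theorem State.setReg_mem (σ : State) (x : Reg) (z : ℤ) : (σ.setReg x z).mem = σ.mem := rfl

@[simp] theorem State.write_reg (σ : State) (f : Field) (i z : ℤ) :
    (σ.write f i z).reg = σ.reg := rfl

@[simp] theorem State.write_mem (σ : State) (f g : Field) (i z : ℤ) :
    (σ.write f i z).mem g = if g = f then Function.update (σ.mem f) i z else σ.mem g := by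
  funext j
  by_cases h : g = f
  · subst h
    simp [State.write, Function.update_apply]
  · simp [State.write, h]

@[simp] theorem State.emit_reg (σ : State) (a b c : ℤ) : (σ.emit a b c).reg = σ.reg := rfl

@[simp] theorem State.emit_mem (σ : State) (a b c : ℤ) : (σ.emit a b c).mem = σ.mem := rfl

@[simp] theorem State.enter_mem (σ : State) (a b : ℤ) : (σ.enter a b).mem = σ.mem := rfl

@[simp] theorem State.enter_reg_u (σ : State) (a b : ℤ) : (σ.enter a b).reg .u = a := rfl

attribute [simp] Expr.eval Test.holds

/-- `Linked next h xs`: the linked list with head `h` and successor function `next` is `xs`. -/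
def Linked (next : ℤ → ℤ) : ℤ → List ℤ → Prop
  | h, [] => h = 0
  | h, x :: xs => h = x ∧ x ≠ 0 ∧ Linked next (next x) xs

theorem Linked.congr {next next' : ℤ → ℤ} {h : ℤ} {xs : List ℤ} (H : Linked next h xs)
    (hn : ∀ x ∈ xs, next' x = next x) : Linked next' h xs := by
  induction xs generalizing h with
  | nil => exact H
  | cons x xs ih =>
    refine ⟨H.1, H.2.1, ?_⟩
    rw [hn x (by simp)]
    exact ih H.2.2 fun y hy => hn y (by simp [hy])

theorem Linked.of_append {next : ℤ → ℤ} {h : ℤ} {xs ys : List ℤ} (H : Linked next h (xs ++ ys)) :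
    ∃ h', Linked next h' ys := by
  induction xs generalizing h with
  | nil => exact ⟨h, H⟩
  | cons x xs ih => exact ih H.2.2

theorem Linked.concat {next next' : ℤ → ℤ} {h z c : ℤ} {xs : List ℤ}
    (H : Linked next h (xs ++ [z])) (hxs : ∀ x ∈ xs, next' x = next x) (hz : next' z = c)
    (hc : c ≠ 0) (hc' : next' c = 0) : Linked next' h (xs ++ [z] ++ [c]) := by
  induction xs generalizing h with
  | nil => exact ⟨H.1, H.2.1, hz, hc, hc'⟩
  | cons x xs ih =>
    refine ⟨H.1, H.2.1, ?_⟩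
    rw [hxs x (by simp)]
    exact ih H.2.2 fun y hy => hxs y (by simp [hy])

theorem nodeRef_ne_zero {n : ℕ} (v : Fin n) : nodeRef v ≠ 0 := by
  simp only [nodeRef]
  omega

theorem nodeRef_inj {n : ℕ} {v w : Fin n} : nodeRef v = nodeRef w ↔ v = w := by
  simp [nodeRef, Fin.ext_iff]

/-- The fields that make up the lists `l(v)`. -/
def heapFields : List Field := [.lHead, .lTail, .val, .link, .free]

/-- The lists `l(v)` consist of the cells `cells v`. -/
structure Heap {n : ℕ} (σ : State) (cells : Fin n → List ℤ) : Prop where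
  linked : ∀ v, Linked (σ.mem .link) (σ.mem .lHead (nodeRef v)) (cells v)
  tail : ∀ v, σ.mem .lTail (nodeRef v) = (cells v).getLastD 0
  nodup : ∀ v, (cells v).Nodup
  disjoint : ∀ v w, v ≠ w → ∀ c ∈ cells v, c ∉ cells w
  used : ∀ v, ∀ c ∈ cells v, 0 < c ∧ c ≤ σ.mem .free 0
  free_nonneg : 0 ≤ σ.mem .free 0
  fresh : ∀ c, σ.mem .free 0 < c → σ.mem .link c = 0

variable {n : ℕ} {σ σ' : State} {cells : Fin n → List ℤ}

theorem Heap.of_mem_eq (H : Heap σ cells) (h : ∀ f ∈ heapFields, σ'.mem f = σ.mem f) :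
    Heap σ' cells := by
  obtain ⟨h₁, h₂, h₃, h₄, h₅, h₆, h₇⟩ := H
  constructor
  · rwa [h .link (by decide), h .lHead (by decide)]
  · rwa [h .lTail (by decide)]
  · exact h₃
  · exact h₄
  · rwa [h .free (by decide)]
  · rwa [h .free (by decide)]
  · rwa [h .free (by decide), h .link (by decide)]

theorem Heap.disjoint_update (H : Heap σ cells) {v : Fin n} {c : ℤ} {xs : List ℤ}
    (hc : σ.mem .free 0 < c) (hxs : ∀ x, x ∈ xs ↔ x = c ∨ x ∈ cells v) :
    ∀ v' w, v' ≠ w → ∀ x ∈ Function.update cells v xs v', x ∉ Function.update cells v xs w := by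
  intro v' w hne x hx hx'
  have hd := H.disjoint v' w hne x
  have h₁ := H.used v' x
  have h₂ := H.used w x
  by_cases h : v' = v
  · subst h
    rw [Function.update_self, hxs] at hx
    rw [Function.update_of_ne hne.symm] at hx'
    rcases hx with rfl | hx
    · linarith [(h₂ hx').2]
    · exact hd hx hx'
  · rw [Function.update_of_ne h] at hx
    by_cases h' : w = v
    · subst h'
      rw [Function.update_self, hxs] at hx'
      rcases hx' with rfl | hx'
      · linarith [(h₁ hx).2]
      · exact hd hx hx'
    · rw [Function.update_of_ne h'] at hx'
      exact hd hx hx'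

/-- The link of the new cell is never written: by `fresh` it is still 0 and terminates the list.
Since the lists are disjoint and free of repetitions, redirecting the last cell of `l(v)` affects no
other link of any list. -/
theorem Heap.append (H : Heap σ cells) {v : Fin n} {c : ℤ} (hc : c = σ.mem .free 0 + 1)
    (hfree : σ'.mem .free 0 = c)
    (hlink : ∀ j, σ'.mem .link j = if σ.mem .lTail (nodeRef v) ≠ 0 ∧ j = σ.mem .lTail (nodeRef v)
      then c else σ.mem .link j)
    (hhead : ∀ j, σ'.mem .lHead j = if σ.mem .lTail (nodeRef v) = 0 ∧ j = nodeRef v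
      then c else σ.mem .lHead j)
    (htail : ∀ j, σ'.mem .lTail j = if j = nodeRef v then c else σ.mem .lTail j) :
    Heap σ' (Function.update cells v (cells v ++ [c])) := by
  have hfresh : σ.mem .free 0 < c := by omega
  have hf := H.free_nonneg
  constructor
  · intro w
    by_cases hw : w = v
    · subst hw
      rw [Function.update_self]
      have hl := H.linked w
      have ht := H.tail w
      have hu := H.used w
      have hn := H.nodup w
      rcases List.eq_nil_or_concat (cells w) with h | ⟨xs, z, h⟩
      · rw [h] at ht ⊢
        simp at ht
        refine ⟨by simp [hhead, ht], by omega, ?_⟩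
        simp [hlink, ht, H.fresh c hfresh, Linked]
      · rw [List.concat_eq_append] at h
        rw [h] at hl ht hu hn ⊢
        simp only [List.getLastD_concat] at ht
        have hz := hu z (by simp)
        have hz0 : z ≠ 0 := by omega
        have : σ'.mem .lHead (nodeRef w) = σ.mem .lHead (nodeRef w) := by simp [hhead, ht, hz0]
        rw [this]
        refine hl.concat (fun x hx => ?_) (by simp [hlink, ht, hz0]) (by omega) ?_
        · have : x ≠ z := by
            rintro rfl
            simp [List.nodup_append] at hn
            exact hn.2 x hx rfl
          simp [hlink, ht, this]
        · have : c ≠ z := by omega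
          simp [hlink, ht, this, H.fresh c hfresh]
    · rw [Function.update_of_ne hw]
      have : σ'.mem .lHead (nodeRef w) = σ.mem .lHead (nodeRef w) := by
        simp [hhead, nodeRef_inj, hw]
      rw [this]
      refine (H.linked w).congr fun x hx => ?_
      rw [hlink, if_neg]
      rintro ⟨h0, hx'⟩
      rw [H.tail v] at h0 hx'
      refine H.disjoint w v hw x hx ?_
      rcases List.eq_nil_or_concat (cells v) with h | ⟨xs, z, h⟩
      · simp [h] at h0
      · rw [List.concat_eq_append] at h
        rw [h] at hx' ⊢
        simp at hx'
        simp [hx']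
  · intro w
    by_cases hw : w = v
    · subst hw
      rw [Function.update_self, List.getLastD_concat, htail, if_pos rfl]
    · rw [Function.update_of_ne hw, htail, if_neg (by rwa [nodeRef_inj]), H.tail]
  · intro w
    by_cases hw : w = v
    · subst hw
      rw [Function.update_self]
      refine List.nodup_append.2 ⟨H.nodup w, by simp, fun x hx y hy => ?_⟩
      have := (H.used w x hx).2
      simp at hy
      omega
    · rw [Function.update_of_ne hw]
      exact H.nodup w
  · exact H.disjoint_update hfresh (by simp [or_comm])
  · intro w x hx
    rw [hfree]
    by_cases hw : w = v
    · subst hw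
      rw [Function.update_self, List.mem_append, List.mem_singleton] at hx
      rcases hx with hx | rfl
      · have := H.used w x hx
        omega
      · omega
    · rw [Function.update_of_ne hw] at hx
      have := H.used w x hx
      omega
  · omega
  · intro x hx
    rw [hlink, if_neg, H.fresh x (by omega)]
    rintro ⟨h0, hx'⟩
    rw [H.tail v] at h0 hx'
    have hu := H.used v
    rcases List.eq_nil_or_concat (cells v) with h | ⟨xs, z, h⟩
    · simp [h] at h0
    · rw [List.concat_eq_append] at h
      rw [h] at hx' hu
      simp at hx'
      have := hu z (by simp)
      omega

/-- The new cell occurs in no list, so setting its link disturbs none of them; the tail moves only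
if the list was empty. -/
theorem Heap.cons (H : Heap σ cells) {v : Fin n} {c : ℤ} (hc : c = σ.mem .free 0 + 1)
    (hfree : σ'.mem .free 0 = c)
    (hlink : ∀ j, σ'.mem .link j = if j = c then σ.mem .lHead (nodeRef v) else σ.mem .link j)
    (hhead : ∀ j, σ'.mem .lHead j = if j = nodeRef v then c else σ.mem .lHead j)
    (htail : ∀ j, σ'.mem .lTail j = if σ.mem .lHead (nodeRef v) = 0 ∧ j = nodeRef v
      then c else σ.mem .lTail j) :
    Heap σ' (Function.update cells v (c :: cells v)) := by
  have hfresh : σ.mem .free 0 < c := by omega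
  have hf := H.free_nonneg
  have hne : ∀ w, ∀ x ∈ cells w, x ≠ c := fun w x hx => by
    have := H.used w x hx
    omega
  constructor
  · intro w
    by_cases hw : w = v
    · subst hw
      rw [Function.update_self]
      refine ⟨by simp [hhead], by omega, ?_⟩
      rw [hlink, if_pos rfl]
      exact (H.linked w).congr fun x hx => by rw [hlink, if_neg (hne w x hx)]
    · rw [Function.update_of_ne hw, hhead, if_neg (by rwa [nodeRef_inj])]
      exact (H.linked w).congr fun x hx => by rw [hlink, if_neg (hne w x hx)]
  · intro w
    rw [htail]
    by_cases hw : w = v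
    · subst hw
      rw [Function.update_self]
      have hl := H.linked w
      have hu := H.used w
      have ht := H.tail w
      cases h : cells w with
      | nil =>
        rw [h] at hl
        simp [show σ.mem .lHead (nodeRef w) = 0 from hl]
      | cons x xs =>
        rw [h] at hl hu ht
        have := hu x (by simp)
        rw [if_neg (by rw [hl.1]; omega), ht]
        simp
    · rw [Function.update_of_ne hw, if_neg (by simp [nodeRef_inj, hw]), H.tail]
  · intro w
    by_cases hw : w = v
    · subst hw
      rw [Function.update_self]
      exact List.nodup_cons.2 ⟨fun h => hne w c h rfl, H.nodup w⟩
    · rw [Function.update_of_ne hw]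
      exact H.nodup w
  · exact H.disjoint_update hfresh (by simp)
  · intro w x hx
    rw [hfree]
    by_cases hw : w = v
    · subst hw
      rw [Function.update_self, List.mem_cons] at hx
      rcases hx with rfl | hx
      · omega
      · have := H.used w x hx
        omega
    · rw [Function.update_of_ne hw] at hx
      have := H.used w x hx
      omega
  · omega
  · intro x hx
    rw [hlink, if_neg (by omega), H.fresh x (by omega)]

/-- The specification of `append`. -/
theorem runs_append (H : Heap σ cells) (v : Fin n) {x e : Expr} (he : e.mild)
    (hx : ∀ σ' : State, σ'.reg .u = σ.reg .u → σ'.reg .v = σ.reg .v →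
      σ'.mem .par = σ.mem .par → x.eval σ' = nodeRef v) :
    Runs n (append x e) σ fun σ' N m =>
      (∃ c, Heap σ' (Function.update cells v (cells v ++ [c]))) ∧
      (∀ y, y ≠ .c → σ'.reg y = σ.reg y) ∧ (∀ f, f ∉ heapFields → σ'.mem f = σ.mem f) ∧
      N ≤ 12 ∧ m = 0 := by
  -- The address `x` is evaluated again at each access. In between, only the register `c` and the
  -- heap fields change, so `hx` covers every evaluation.
  simp only [append, newCell, block, runs_seq, runs_set, runs_wr, runs_cond, runs_skip, he, true_or,
    true_and]
  set c := σ.mem .free 0 + 1 with hc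
  have hpos : c ≠ 0 := by
    have := H.free_nonneg
    omega
  refine ⟨.inl rfl, .inl rfl, fun h => ⟨.inl rfl, .inl rfl, ?_⟩, fun h => ⟨.inl rfl, .inl rfl, ?_⟩⟩
  · simp [hx] at h
    refine ⟨⟨c, H.append hc ?_ ?_ ?_ ?_⟩, fun y hy => by simp [hy], fun f hf => ?_, ?_, ?_⟩
    · simp [hc]
    · simp [h]
    · simp [hx, h, Function.update_apply, hc]
    · simp [hx, Function.update_apply, hc]
    · simp [heapFields] at hf
      simp [hf]
    · norm_num
    · trivial
  · simp [hx] at h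
    refine ⟨⟨c, H.append hc ?_ ?_ ?_ ?_⟩, fun y hy => by simp [hy], fun f hf => ?_, ?_, ?_⟩
    · simp [hc]
    · simp [hx, h, Function.update_apply, hc]
    · simp [h]
    · simp [hx, Function.update_apply, hc]
    · simp [heapFields] at hf
      simp [hf]
    · norm_num
    · trivial

/-- The specification of `insertFront`. -/
theorem runs_insertFront (H : Heap σ cells) (v : Fin n) {x e : Expr} (he : e.mild) (hxf : x.flat)
    (hx : ∀ σ' : State, σ'.reg .u = σ.reg .u → x.eval σ' = nodeRef v) :
    Runs n (insertFront x e) σ fun σ' N m =>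
      (∃ c, Heap σ' (Function.update cells v (c :: cells v))) ∧
      (∀ y, y ≠ .c → σ'.reg y = σ.reg y) ∧ (∀ f, f ∉ heapFields → σ'.mem f = σ.mem f) ∧
      N ≤ 12 ∧ m = 0 := by
  simp only [insertFront, newCell, block, runs_seq, runs_set, runs_wr, runs_cond, runs_skip, he,
    true_or, true_and]
  set c := σ.mem .free 0 + 1 with hc
  refine ⟨.inl rfl, .inl rfl, .inl ?_, fun h => ⟨.inl rfl, .inl rfl, ?_⟩, fun h => ⟨.inl rfl, ?_⟩⟩
  · simpa [Expr.mild, Expr.flat] using hxf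
  · simp [hx] at h
    refine ⟨⟨c, H.cons hc ?_ ?_ ?_ ?_⟩, fun y hy => by simp [hy], fun f hf => ?_, ?_, ?_⟩
    · simp [hc]
    · simp [hx, Function.update_apply, hc]
    · simp [hx, Function.update_apply, hc]
    · simp [hx, h, Function.update_apply, hc]
    · simp [heapFields] at hf
      simp [hf]
    · norm_num
    · trivial
  · simp [hx] at h
    refine ⟨⟨c, H.cons hc ?_ ?_ ?_ ?_⟩, fun y hy => by simp [hy], fun f hf => ?_, ?_, ?_⟩
    · simp [hc]
    · simp [hx, Function.update_apply, hc]
    · simp [hx, Function.update_apply, hc]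
    · simp [h]
    · simp [heapFields] at hf
      simp [hf]
    · norm_num
    · trivial

/-! ### The effect of `send_agent` -/

/-- The demands stored in the memory. -/
def State.dem (σ : State) (v : Fin n) : ℤ := σ.mem .d (nodeRef v)

/-- `l` is the stored list of the children of `u` with positive demand. -/
structure PosList (t : ParentMap n) (σ : State) (u : Fin n) (l : List (Fin n)) : Prop where
  linked : Linked (σ.mem .nextPos) (σ.mem .pos (nodeRef u)) (l.map nodeRef)
  nodup : l.Nodup
  mem_iff : ∀ c, c ∈ l ↔ c ∈ t.children u ∧ 0 < σ.dem c

/-- The effect of a call to `send_agent` at `u` on the demands and on the lists of cells. -/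
inductive Send (t : ParentMap n) (u : Fin n) (d : Fin n → ℤ) (cells : Fin n → List ℤ) :
    (Fin n → ℤ) → (Fin n → List ℤ) → Prop
  | up (c) : d u < 0 → u ≠ t.root →
      Send t u d cells (Function.update d u (d u + 1))
        (Function.update cells (t.par u) (cells (t.par u) ++ [c]))
  | down (v) (c) : 0 ≤ d u → v ∈ t.children u → 0 < d v →
      Send t u d cells (Function.update d v (d v - 1))
        (Function.update cells v (cells v ++ [c]))
  | stay : 0 ≤ d u → (∀ v ∈ t.children u, d v ≤ 0) → Send t u d cells d cells

theorem State.dem_eq_update {σ σ' : State} {v : Fin n} {z : ℤ}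
    (h : σ'.mem .d = Function.update (σ.mem .d) (nodeRef v) z) :
    (σ'.dem : Fin n → ℤ) = Function.update σ.dem v z := by
  funext w
  simp [State.dem, h, Function.update_apply, nodeRef_inj]

theorem ne_of_mem_heapFields {f : Field} (h : f ∈ heapFields) : f ≠ .d ∧ f ≠ .pos := by
  constructor <;>
  · rintro rfl
    revert h
    decide

/-- The specification of `send_agent`. -/
theorem runs_sendAgent {t : ParentMap n} {u : Fin n} {l : List (Fin n)} (H : Heap σ cells)
    (hu : σ.reg .u = nodeRef u) (hpar : u ≠ t.root → σ.mem .par (nodeRef u) = nodeRef (t.par u))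
    (hroot : σ.dem u < 0 → u ≠ t.root) (hl : PosList t σ u l) :
    Runs n sendAgentCode σ fun σ' N m =>
      (∃ cells', Heap σ' cells' ∧ Send t u σ.dem cells σ'.dem cells') ∧
      (∃ l', PosList t σ' u l') ∧
      (∀ v : Fin n, v ≠ u → σ'.mem .pos (nodeRef v) = σ.mem .pos (nodeRef v)) ∧
      (∀ f, f ∉ heapFields → f ≠ .d → f ≠ .pos → σ'.mem f = σ.mem f) ∧
      N ≤ 40 ∧ m = 0 := by
  have hmem := hl.mem_iff
  have hne : ∀ c ∈ t.children u, c ≠ u := fun c hc h =>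
    ParentMap.not_mem_subtree_of_mem_children hc (h ▸ ParentMap.self_mem_subtree c)
  simp only [sendAgentCode, block, runs_cond, runs_seq, runs_set, runs_wr, runs_emit, runs_skip]
  refine ⟨fun hd => ?_, fun hd => ⟨fun hp => ⟨.inl rfl, ?_⟩, fun hp => ?_⟩⟩
  -- Upward move. Only the demand of `u` changes, which is not the demand of a child of `u`, so the
  -- list of positive children stays correct.
  · simp only [Test.holds, Expr.eval, hu] at hd
    have hr := hroot hd
    refine (runs_append H (t.par u) rfl fun σ' h₁ _ h₂ => ?_).mono ?_
    · simp [h₁, h₂, hu, hpar hr]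
    · rintro σ₁ N m ⟨⟨c, H₁⟩, hreg, hmem₁, hN, rfl⟩
      have hd₁ : σ₁.mem .d = σ.mem .d := hmem₁ _ (by decide)
      have hsend : ∀ τ : State, τ.mem .d = Function.update (σ.mem .d) (nodeRef u) (σ.dem u + 1) →
          Send t u σ.dem cells τ.dem
            (Function.update cells (t.par u) (cells (t.par u) ++ [c])) := fun τ h => by
        rw [State.dem_eq_update h]
        exact .up c hd hr
      refine ⟨.inl rfl, ?_⟩
      refine ⟨⟨_, H₁.of_mem_eq fun f hf => ?_, ?_⟩, ⟨l, ?_, hl.nodup, fun c' => ?_⟩, fun v _ => ?_,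
        fun f hf hfd _ => ?_, by omega, by omega⟩
      · simp [(ne_of_mem_heapFields hf).1]
      · exact hsend _ (by simp [hd₁, hreg .u (by decide), hu, State.dem])
      · simpa [hmem₁ .nextPos (by decide), hmem₁ .pos (by decide)] using hl.linked
      · rw [State.dem_eq_update (σ := σ) (v := u) (z := σ.dem u + 1), hmem]
        · refine and_congr_right fun hc => ?_
          rw [Function.update_of_ne (hne c' hc)]
        · simp [hd₁, hreg .u (by decide), hu, State.dem]
      · simp [hmem₁ .pos (by decide)]
      · simp [hfd, hmem₁ f hf]
  · simp only [Test.holds, Expr.eval, hu] at hd hp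
    have hlink := hl.linked
    have hnodup := hl.nodup
    obtain _ | ⟨v, l'⟩ := l
    · exact absurd hlink hp
    obtain ⟨hpos, -, hlink⟩ := hlink
    obtain ⟨hv, hdv⟩ := (hmem v).1 (by simp)
    have hvu := hne v hv
    set σ₀ := σ.setReg .v ((Expr.rd .pos (.get .u)).eval σ) with hσ₀
    have hv₀ : σ₀.reg .v = nodeRef v := by simp [hσ₀, hu, hpos]
    have hu₀ : σ₀.reg .u = nodeRef u := by simp [hσ₀, hu]
    have hm₀ : σ₀.mem = σ.mem := by simp [hσ₀]
    have H₀ : Heap σ₀ cells := H.of_mem_eq fun f _ => by rw [hm₀]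
    refine (runs_append H₀ v rfl fun σ' _ h₁ _ => ?_).mono ?_
    · simp [h₁, hv₀]
    · rintro σ₁ N m ⟨⟨c, H₁⟩, hreg, hmem₁, hN, rfl⟩
      rw [hm₀] at hmem₁
      have hd₁ : σ₁.mem .d = σ.mem .d := hmem₁ _ (by decide)
      have hp₁ : σ₁.mem .pos = σ.mem .pos := hmem₁ _ (by decide)
      have hn₁ : σ₁.mem .nextPos = σ.mem .nextPos := hmem₁ _ (by decide)
      have hv₁ : σ₁.reg .v = nodeRef v := by rw [hreg _ (by decide), hv₀]
      have hu₁ : σ₁.reg .u = nodeRef u := by rw [hreg _ (by decide), hu₀]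
      have hd0 : 0 ≤ σ.dem u := not_lt.1 hd
      have hdem : ∀ τ : State, τ.mem .d = Function.update (σ.mem .d) (nodeRef v) (σ.dem v - 1) →
          (τ.dem : Fin n → ℤ) = Function.update σ.dem v (σ.dem v - 1) := fun τ =>
        State.dem_eq_update
      have hsend : ∀ τ : State, τ.mem .d = Function.update (σ.mem .d) (nodeRef v) (σ.dem v - 1) →
          Send t u σ.dem cells τ.dem (Function.update cells v (cells v ++ [c])) := fun τ h => by
        rw [hdem τ h]
        exact .down v c hd0 hv hdv
      refine ⟨.inl rfl, fun hz => ⟨.inl rfl, ?_⟩, fun hz => ?_⟩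
      -- The demand of the first child in the list has reached 0, so dropping the head restores
      -- exactness.
      · simp [hv₁, hd₁] at hz
        have hz' : σ.dem v - 1 = 0 := hz
        refine ⟨⟨_, H₁.of_mem_eq fun f hf => ?_, ?_⟩, ⟨l', ?_, (List.nodup_cons.1 hnodup).2,
          fun c' => ?_⟩, fun w hw => ?_, fun f hf hfd hfp => ?_, by omega, by omega⟩
        · simp [(ne_of_mem_heapFields hf).1, (ne_of_mem_heapFields hf).2]
        · exact hsend _ (by simp [hd₁, hv₁, State.dem])
        · simpa [hu₁, hv₁, hn₁] using hlink
        · rw [hdem _ (by simp [hd₁, hv₁, State.dem])]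
          by_cases hc : c' = v
          · subst hc
            simp [hz', (List.nodup_cons.1 hnodup).1]
          · rw [Function.update_of_ne hc, ← hmem c']
            simp [hc]
        · simp [hu₁, hp₁, nodeRef_inj, hw]
        · simp [hfd, hfp, hmem₁ f hf]
      · simp [hv₁, hd₁] at hz
        have hz' : ¬ σ.dem v - 1 = 0 := hz
        refine ⟨⟨_, H₁.of_mem_eq fun f hf => ?_, ?_⟩, ⟨v :: l', ?_, hnodup,
          fun c' => ?_⟩, fun w hw => ?_, fun f hf hfd hfp => ?_, by omega, by omega⟩
        · simp [(ne_of_mem_heapFields hf).1]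
        · exact hsend _ (by simp [hd₁, hv₁, State.dem])
        · simpa [hn₁, hp₁] using hl.linked
        · rw [hdem _ (by simp [hd₁, hv₁, State.dem]), hmem c']
          by_cases hc : c' = v
          · subst hc
            rw [Function.update_self]
            exact and_congr_right fun _ => by omega
          · rw [Function.update_of_ne hc]
        · simp [hp₁]
        · simp [hfd, hmem₁ f hf]
  -- A null head means an empty list, hence no child of positive demand.
  · simp only [Test.holds, Expr.eval, hu, ne_eq, not_not] at hd hp
    refine ⟨⟨cells, H, .stay (not_lt.1 hd) fun v hv => ?_⟩, ⟨l, hl⟩, by simp, by simp, by simp, by simp⟩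
    by_contra hlt
    have hvl := (hmem v).2 ⟨hv, not_le.1 hlt⟩
    have hlink := hl.linked
    rw [hp] at hlink
    obtain _ | ⟨w, l'⟩ := l
    · simp at hvl
    · exact hlink.2.1 hlink.1.symm

end RAM

/-! ## The computation of the demands -/

namespace RAM

open UPMT ParentMap

variable {n : ℕ}

/-- The memory holds the tree `t`, the agents `A` and the targets `B`. -/
structure Input (t : ParentMap n) (A B : Finset (Fin n)) (σ : State) : Prop where
  par : ∀ v, v ≠ t.root → σ.mem .par (nodeRef v) = nodeRef (t.par v)
  children : ∀ u, Linked (σ.mem .sib) (σ.mem .child (nodeRef u)) ((t.children u).map nodeRef)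
  agent : ∀ v, σ.mem .agent (nodeRef v) = if v ∈ A then 1 else 0
  target : ∀ v, σ.mem .target (nodeRef v) = if v ∈ B then 1 else 0

/-- The fields that hold the input and the lists of children. -/
def inputFields : List Field := [.par, .child, .sib, .agent, .target]

variable {t : ParentMap n} {A B : Finset (Fin n)} {σ σ' : State} {u v : Fin n}

theorem Input.of_mem_eq (h : Input t A B σ) (hf : ∀ f ∈ inputFields, σ'.mem f = σ.mem f) :
    Input t A B σ' := by
  obtain ⟨h₁, h₂, h₃, h₄⟩ := h
  constructor
  · rwa [hf .par (by decide)]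
  · rwa [hf .child (by decide), hf .sib (by decide)]
  · rwa [hf .agent (by decide)]
  · rwa [hf .target (by decide)]

theorem PosList.congr {l : List (Fin n)} (h : PosList t σ v l)
    (hpos : σ'.mem .pos (nodeRef v) = σ.mem .pos (nodeRef v))
    (hnext : ∀ c ∈ t.children v, σ'.mem .nextPos (nodeRef c) = σ.mem .nextPos (nodeRef c))
    (hdem : ∀ c ∈ t.children v, σ'.dem c = σ.dem c) : PosList t σ' v l := by
  refine ⟨?_, h.nodup, fun c => ?_⟩
  · rw [hpos]
    refine h.linked.congr fun x hx => ?_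
    obtain ⟨c, hc, rfl⟩ := List.mem_map.1 hx
    exact hnext c ((h.mem_iff c).1 hc).1
  · rw [h.mem_iff]
    exact and_congr_right fun hc => by rw [hdem c hc]

/-- The demand of `v` and the list of its children of positive demand have been computed. -/
def Demanded (t : ParentMap n) (A B : Finset (Fin n)) (σ : State) (v : Fin n) : Prop :=
  σ.dem v = t.demand B A v ∧ ∃ l, PosList t σ v l

theorem natAbs_demand_le_card (u : Fin n) : (t.demand B A u).natAbs ≤ (t.subtree u).card := by
  refine (Int.natAbs_sum_le _ _).trans ?_
  refine (Finset.sum_le_card_nsmul _ _ 1 fun v _ => ?_).trans (by simp)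
  split_ifs <;> simp

theorem card_subtree (u : Fin n) :
    (t.subtree u).card = 1 + ((t.children u).map fun c => (t.subtree c).card).sum := by
  simpa only [Finset.card_eq_sum_ones] using sum_subtree (t := t) (fun _ => 1) u

/-- Adding up demands is the only arithmetic that is not an increment by at most one. This bound
admits it through the alternative "at most `n`" of the unit-cost semantics; it holds because
disjoint subtrees have at most `n` nodes together. -/
theorem natAbs_partial_demand_le {xs ys : List (Fin n)} (h : t.children u = xs ++ ys) :
    ((if u ∈ B then 1 else 0) - (if u ∈ A then 1 else 0) +
      (xs.map (t.demand B A)).sum : ℤ).natAbs ≤ n := by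
  have h₁ : ((if u ∈ B then 1 else 0) - (if u ∈ A then 1 else 0) : ℤ).natAbs ≤ 1 := by
    split_ifs <;> simp
  have h₂ : (xs.map (t.demand B A)).sum.natAbs ≤ (xs.map fun c => (t.subtree c).card).sum := by
    clear h
    induction xs with
    | nil => simp
    | cons x xs ih =>
      have := natAbs_demand_le_card (t := t) (A := A) (B := B) x
      simp only [List.map_cons, List.sum_cons]
      omega
  have h₃ := card_subtree (t := t) u
  have h₄ : (t.subtree u).card ≤ n := by simpa using Finset.card_le_univ (t.subtree u)
  rw [h, List.map_append, List.sum_append] at h₃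
  omega

/-- The invariant of the loop of `demand` at `u`, with the children `ys` still to be visited. -/
structure DemandInv (t : ParentMap n) (A B : Finset (Fin n)) (σ₀ : State) (u : Fin n)
    (ys : List (Fin n)) (σ : State) : Prop where
  reg_u : σ.reg .u = nodeRef u
  reg_v : Linked (σ.mem .sib) (σ.reg .v) (ys.map nodeRef)
  frame : ∀ f, f ≠ .d → f ≠ .pos → f ≠ .nextPos → σ.mem f = σ₀.mem f
  outside : ∀ v ∉ t.subtree u, ∀ f, σ.mem f (nodeRef v) = σ₀.mem f (nodeRef v)
  todo : ∀ y ∈ ys, ∀ v ∈ t.subtree y, σ.mem .pos (nodeRef v) = 0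
  done : ∃ xs, t.children u = xs ++ ys ∧ (∀ x ∈ xs, ∀ v ∈ t.subtree x, Demanded t A B σ v) ∧
    σ.dem u = (if u ∈ B then 1 else 0) - (if u ∈ A then 1 else 0) + (xs.map (t.demand B A)).sum ∧
    ∃ l : List (Fin n), Linked (σ.mem .nextPos) (σ.mem .pos (nodeRef u)) (l.map nodeRef) ∧
      l.Nodup ∧ ∀ c, c ∈ l ↔ c ∈ xs ∧ 0 < t.demand B A c

theorem self_not_mem_subtree_child {c : Fin n} (hc : c ∈ t.children u) (hv : v ∈ t.subtree c) :
    v ≠ u := fun h => not_mem_subtree_of_mem_children hc (h ▸ hv)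

/-- The specification of `demand`. -/
theorem runs_demand (u : Fin n) : ∀ {σ : State}, Input t A B σ → σ.reg .u = nodeRef u →
    (∀ v ∈ t.subtree u, σ.mem .pos (nodeRef v) = 0) →
    Runs n demandCode σ fun σ' N m =>
      (∀ f, f ≠ .d → f ≠ .pos → f ≠ .nextPos → σ'.mem f = σ.mem f) ∧
      (∀ v ∉ t.subtree u, ∀ f, σ'.mem f (nodeRef v) = σ.mem f (nodeRef v)) ∧
      (∀ v ∈ t.subtree u, Demanded t A B σ' v) ∧
      N + 15 ≤ 30 * (t.subtree u).card ∧ m = 0 := by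
  induction u using induction_children (t := t) with
  | _ u ih =>
  intro σ₀ hin hu hpos
  have hlt : ∀ c, 1 ≤ (t.subtree c).card := fun c =>
    Finset.card_pos.2 ⟨c, self_mem_subtree c⟩
  simp only [demandCode, block, runs_seq, runs_wr, runs_set, runs_skip]
  refine ⟨.inr ?_, .inl rfl, ?_⟩
  · simp only [Expr.eval, hu, hin.agent, hin.target]
    have := natAbs_partial_demand_le (t := t) (A := A) (B := B) (u := u) (xs := []) rfl
    simpa using this
  refine (runs_loop_list (DemandInv t A B σ₀ u) (fun y => 30 * (t.subtree y).card - 1) (fun _ => 0)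
    (fun σ h => by simpa [Linked] using h.reg_v) ?_ (t.children u) ?_).mono ?_
  · rintro y ys σ ⟨hru, hrv, hframe, hout, htodo, xs, hxs, hdone, hdem, l, hl, hnd, hml⟩
    have hin' : Input t A B σ := hin.of_mem_eq fun f hf => by
      apply hframe <;> rintro rfl <;> exact absurd hf (by decide)
    have hy : y ∈ t.children u := by simp [hxs]
    have hrv' : σ.reg .v = nodeRef y := hrv.1
    refine ⟨by simpa [hrv'] using nodeRef_ne_zero y, ?_⟩
    simp only [runs_seq, runs_wr, runs_cond, runs_set, runs_skip]
    have hcall := ih y hy (σ := σ.enter (σ.reg .v) 0) (hin'.of_mem_eq fun _ _ => rfl) hrv'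
      (fun v hv => htodo y (by simp) v hv)
    refine runs_call rfl rfl (hcall.mono ?_)
    rintro σ₁ N₁ m₁ ⟨hframe₁, hout₁, hdone₁, hN₁, rfl⟩
    simp only [State.enter_mem] at hframe₁ hout₁
    have huy : u ∉ t.subtree y := not_mem_subtree_of_mem_children hy
    have hdu : σ₁.mem .d (nodeRef u) = σ.dem u := hout₁ u huy _
    have hdy : σ₁.mem .d (nodeRef y) = t.demand B A y := (hdone₁ y (self_mem_subtree y)).1
    have hyu : y ≠ u := self_not_mem_subtree_child hy (self_mem_subtree y)
    have hxs' : t.children u = xs ++ [y] ++ ys := by rw [hxs]; simp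
    have hnodup := nodup_children (t := t) u
    have hyxs : y ∉ xs := fun h => by
      rw [hxs, List.nodup_append] at hnodup
      exact hnodup.2.2 y h y (by simp) rfl
    have hsum : σ.dem u + t.demand B A y = (if u ∈ B then 1 else 0) - (if u ∈ A then 1 else 0) +
        ((xs ++ [y]).map (t.demand B A)).sum := by
      rw [hdem]
      simp [add_assoc]
    -- The part common to both branches: whether or not `y` is put into the list of positive
    -- children, the state differs from that after the recursive call only at `u` and in `nextPos`
    -- at `y`, apart from registers.
    have hfin : ∀ ρ : State, ρ.reg = Function.update σ.reg .v (σ.mem .sib (nodeRef y)) →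
        (∀ f, f ≠ .d → f ≠ .pos → f ≠ .nextPos → ρ.mem f = σ₁.mem f) →
        ρ.mem .d = Function.update (σ₁.mem .d) (nodeRef u) (σ.dem u + t.demand B A y) →
        (∀ v : Fin n, v ≠ u → ρ.mem .pos (nodeRef v) = σ₁.mem .pos (nodeRef v)) →
        (∀ v : Fin n, v ≠ y → ρ.mem .nextPos (nodeRef v) = σ₁.mem .nextPos (nodeRef v)) →
        (∃ l : List (Fin n), Linked (ρ.mem .nextPos) (ρ.mem .pos (nodeRef u)) (l.map nodeRef) ∧
          l.Nodup ∧ ∀ c, c ∈ l ↔ c ∈ xs ++ [y] ∧ 0 < t.demand B A c) →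
        DemandInv t A B σ₀ u ys ρ := by
      intro ρ hreg hmem hd hp hn hl
      have hdne : ∀ v : Fin n, v ≠ u → ρ.dem v = σ₁.dem v := fun v hv => by
        simp [State.dem, hd, nodeRef_inj, hv]
      have hout₂ : ∀ v : Fin n, v ≠ u → v ≠ y → ∀ f, ρ.mem f (nodeRef v) = σ₁.mem f (nodeRef v) := by
        intro v hvu hvy f
        by_cases h₁ : f = .d
        · exact h₁ ▸ hdne v hvu
        by_cases h₂ : f = .pos
        · exact h₂ ▸ hp v hvu
        by_cases h₃ : f = .nextPos
        · exact h₃ ▸ hn v hvy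
        · rw [hmem f h₁ h₂ h₃]
      have hkeep : ∀ c ∈ t.children u, c ≠ y → ∀ v ∈ t.subtree c, ∀ f,
          ρ.mem f (nodeRef v) = σ.mem f (nodeRef v) := by
        intro c hc hcy v hv f
        have hvy : v ∉ t.subtree y := fun h => hcy (eq_of_mem_subtree_children hc hy hv h)
        have hvy' : v ≠ y := by
          rintro rfl
          exact hvy (self_mem_subtree v)
        rw [hout₂ v (self_not_mem_subtree_child hc hv) hvy', hout₁ v hvy]
      refine ⟨by simp [hreg, hru], ?_, fun f h₁ h₂ h₃ => ?_, fun v hv f => ?_, fun z hz v hv => ?_,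
        xs ++ [y], hxs', fun x hx v hv => ?_, ?_, hl⟩
      · rw [hmem _ (by simp) (by simp) (by simp), hframe₁ _ (by simp) (by simp) (by simp), hreg]
        simpa using hrv.2.2
      · rw [hmem f h₁ h₂ h₃, hframe₁ f h₁ h₂ h₃, hframe f h₁ h₂ h₃]
      · have hvu : v ≠ u := fun h => hv (h ▸ self_mem_subtree _)
        have hvy : v ∉ t.subtree y := fun h => hv (mem_subtree_of_mem_children hy h)
        rw [hout₂ v hvu (fun h => hvy (h ▸ self_mem_subtree _)), hout₁ v hvy, hout v hv]
      · have hz' : z ∈ t.children u := by simp [hxs, hz]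
        have hzy : z ≠ y := by
          rintro rfl
          rw [hxs, List.nodup_append] at hnodup
          exact (List.nodup_cons.1 hnodup.2.1).1 hz
        rw [hkeep z hz' hzy v hv]
        exact htodo z (by simp [hz]) v hv
      · rw [List.mem_append, List.mem_singleton] at hx
        rcases hx with hx | rfl
        · have hx' : x ∈ t.children u := by simp [hxs, hx]
          have hxy : x ≠ y := fun h => hyxs (h ▸ hx)
          have hk := hkeep x hx' hxy
          obtain ⟨h₁, l', h₂⟩ := hdone x hx v hv
          refine ⟨(hk v hv .d).trans h₁, l', h₂.congr (hk v hv _) (fun c hc => ?_) fun c hc => ?_⟩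
          · exact hk c (mem_subtree_trans (child_mem_subtree hc) hv) _
          · exact hk c (mem_subtree_trans (child_mem_subtree hc) hv) .d
        · have hvu := self_not_mem_subtree_child hy hv
          obtain ⟨h₁, l', h₂⟩ := hdone₁ v hv
          have hcx : ∀ c ∈ t.children v, c ∈ t.subtree x := fun c hc =>
            mem_subtree_trans (child_mem_subtree hc) hv
          refine ⟨(hdne v hvu).trans h₁, l', h₂.congr (hp v hvu) (fun c hc => hn c ?_)
            fun c hc => hdne c (self_not_mem_subtree_child hy (hcx c hc))⟩
          rintro rfl
          exact not_mem_subtree_of_mem_children hc hv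
      · rw [← hsum, State.dem, hd, Function.update_self]
    have hsib : σ₁.mem .sib = σ.mem .sib := hframe₁ _ (by simp) (by simp) (by simp)
    have hpu : σ₁.mem .pos (nodeRef u) = σ.mem .pos (nodeRef u) := hout₁ u huy _
    have hln : ∀ x ∈ l.map nodeRef, σ₁.mem .nextPos x = σ.mem .nextPos x := by
      intro x hx
      obtain ⟨c, hc, rfl⟩ := List.mem_map.1 hx
      have hcx := ((hml c).1 hc).1
      refine hout₁ c (fun h => hyxs ?_) _
      rwa [← eq_of_mem_subtree_children (by simp [hxs, hcx]) hy (self_mem_subtree c) h]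
    refine ⟨by simp, fun τ hτr hτm => ⟨.inr ?_, fun hp => ⟨.inl rfl, .inl rfl, .inl rfl, ?_⟩,
      fun hp => ⟨.inl rfl, ?_⟩⟩⟩
    · simp only [Expr.eval, hτr, hτm, hru, hrv', hdu, hdy, hsum]
      exact natAbs_partial_demand_le hxs'
    · simp [hτr, hτm, hru, hrv', nodeRef_inj, hyu, hdy] at hp
      refine ⟨hfin _ ?_ ?_ ?_ ?_ ?_ ⟨y :: l, ⟨?_, ?_, ?_⟩, ?_, fun c => ?_⟩, ?_, ?_⟩
      · simp [hτr, hτm, hrv', hsib]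
      · intro f h₁ h₂ h₃
        simp [h₁, h₂, h₃, hτm]
      · simp [hτr, hτm, hru, hrv', hdu, hdy]
      · intro v hv
        simp [hτr, hτm, hru, nodeRef_inj, hv]
      · intro v hv
        simp [hτr, hτm, hrv', nodeRef_inj, hv]
      · simp [hτr, hru, hrv']
      · exact nodeRef_ne_zero y
      · simp only [State.setReg_mem, State.write_mem, hτr, hτm, hru, hrv', Expr.eval, State.write_reg]
        simp only [reduceCtorEq, if_false, if_true, Function.update_self, hpu]
        refine (hl.congr hln).congr fun x hx => ?_
        obtain ⟨c, hc, rfl⟩ := List.mem_map.1 hx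
        have : c ≠ y := fun h => hyxs (h ▸ ((hml c).1 hc).1)
        simp [nodeRef_inj, this]
      · exact List.nodup_cons.2 ⟨fun h => hyxs ((hml y).1 h).1, hnd⟩
      · rw [List.mem_cons, hml, List.mem_append, List.mem_singleton]
        constructor
        · rintro (rfl | h)
          exacts [⟨.inr rfl, hp⟩, ⟨.inl h.1, h.2⟩]
        · rintro ⟨h | h, h'⟩
          exacts [.inr ⟨h, h'⟩, .inl h]
      · omega
      · simp
    · simp [hτr, hτm, hru, hrv', nodeRef_inj, hyu, hdy] at hp
      refine ⟨hfin _ ?_ ?_ ?_ ?_ ?_ ⟨l, ?_, hnd, fun c => ?_⟩, ?_, ?_⟩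
      · simp [hτr, hτm, hrv', hsib]
      · intro f h₁ h₂ h₃
        simp [h₁, hτm]
      · simp [hτr, hτm, hru, hrv', hdu, hdy]
      · intro v hv
        simp [hτm]
      · intro v hv
        simp [hτm]
      · simpa [hτm, hpu] using hl.congr hln
      · rw [hml, List.mem_append, List.mem_singleton]
        constructor
        · rintro h
          exact ⟨.inl h.1, h.2⟩
        · rintro ⟨h | rfl, h'⟩
          exacts [⟨h, h'⟩, absurd h' (not_lt.2 hp)]
      · omega
      · simp
  · refine ⟨by simp [hu], by simpa [hu] using hin.children u, fun f hfd _ _ => by simp [hfd],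
      fun v hv f => ?_, fun y hy v hv => ?_, [], rfl, by simp, ?_, [], ?_, by simp, by simp⟩
    · by_cases hf : f = .d
      · have : v ≠ u := by
          rintro rfl
          exact hv (self_mem_subtree v)
        simp [hf, hu, nodeRef_inj, this]
      · simp [hf]
    · simpa using hpos v (mem_subtree_of_mem_children hy hv)
    · simp [State.dem, hu, hin.agent, hin.target]
    · simpa [Linked] using hpos u (self_mem_subtree u)
  · rintro σ N m ⟨⟨hru, hrv, hframe, hout, htodo, xs, hxs, hdone, hdem, l, hl, hnd, hml⟩, hN, hm⟩
    rw [List.append_nil] at hxs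
    subst hxs
    refine ⟨hframe, hout, fun v hv => ?_, ?_, by simpa using hm⟩
    · rcases mem_subtree_iff.1 hv with rfl | ⟨c, hc, hv⟩
      · exact ⟨hdem.trans (demand_eq v).symm, l, hl, hnd, fun c => by
          rw [hml]
          refine and_congr_right fun hc => ?_
          rw [(hdone c hc c (self_mem_subtree c)).1]⟩
      · exact hdone c hc v hv
    · have h₁ : ((t.children u).map fun y => 30 * (t.subtree y).card - 1 + 1) =
          (t.children u).map fun y => 30 * (t.subtree y).card :=
        List.map_congr_left fun c _ => by have := hlt c; omega
      rw [h₁, List.sum_map_mul_left] at hN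
      rw [card_subtree]
      omega

end RAM

/-! ## The specification of `direct_traffic` -/

namespace RAM

open UPMT ParentMap

variable {n : ℕ} {t : ParentMap n} {A B : Finset (Fin n)} {σ σ' : State}
  {cells cells' : Fin n → List ℤ} {u v : Fin n}

/-- The fields that do not change any more once the demands have been computed. -/
def staticFields : List Field := [.par, .child, .sib, .agent, .target, .nextPos]

/-- The attributes of `v` are the same in two states, up to the cells of `l(v)`. -/
structure Agree (σ : State) (cells : Fin n → List ℤ) (σ' : State) (cells' : Fin n → List ℤ)
    (v : Fin n) : Prop where
  dem : σ'.dem v = σ.dem v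
  pos : σ'.mem .pos (nodeRef v) = σ.mem .pos (nodeRef v)
  processed : σ'.mem .processed (nodeRef v) = σ.mem .processed (nodeRef v)
  length : (cells' v).length = (cells v).length

/-- No call has affected `v`. -/
structure Untouched (t : ParentMap n) (A B : Finset (Fin n)) (σ : State)
    (cells : Fin n → List ℤ) (v : Fin n) : Prop where
  dem : σ.dem v = t.demand B A v
  length : (cells v).length = 0
  processed : σ.mem .processed (nodeRef v) = 0
  posList : ∃ l, PosList t σ v l

/-- `direct_traffic(u)` may be called: all agents from outside of the subtree have arrived. -/
structure Ready (t : ParentMap n) (A B : Finset (Fin n)) (σ : State)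
    (cells : Fin n → List ℤ) (u : Fin n) : Prop where
  below : ∀ c ∈ t.children u, ∀ v ∈ t.subtree c, Untouched t A B σ cells v
  dem : σ.dem u = min (t.demand B A u) 0
  length : ((cells u).length : ℤ) = max (t.demand B A u) 0
  processed : σ.mem .processed (nodeRef u) = 0
  posList : ∃ l, PosList t σ u l

/-- The effect of `direct_traffic(u)`. -/
structure Served (t : ParentMap n) (A B : Finset (Fin n)) (u : Fin n) (σ : State)
    (cells : Fin n → List ℤ) (σ' : State) (cells' : Fin n → List ℤ) : Prop where
  static : ∀ f ∈ staticFields, σ'.mem f = σ.mem f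
  heap : Heap σ' cells'
  agree : ∀ v ∉ t.subtree u, v ≠ t.par u → Agree σ cells σ' cells' v
  dem_par : t.par u ∉ t.subtree u → σ'.dem (t.par u) = σ.dem (t.par u)
  pos_par : t.par u ∉ t.subtree u →
    σ'.mem .pos (nodeRef (t.par u)) = σ.mem .pos (nodeRef (t.par u))
  processed_par : t.par u ∉ t.subtree u →
    σ'.mem .processed (nodeRef (t.par u)) = σ.mem .processed (nodeRef (t.par u))
  length_par : t.par u ∉ t.subtree u →
    (cells' (t.par u)).length = (cells (t.par u)).length + (-t.demand B A u).toNat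
  dem : σ'.dem u = 0
  processed : σ'.mem .processed (nodeRef u) = 1

theorem Input.of_static (h : Input t A B σ) (hf : ∀ f ∈ staticFields, σ'.mem f = σ.mem f) :
    Input t A B σ' :=
  h.of_mem_eq fun f hf' => hf f (by revert hf'; cases f <;> decide)

theorem PosList.of_agree (hs : ∀ f ∈ staticFields, σ'.mem f = σ.mem f)
    (hpos : σ'.mem .pos (nodeRef v) = σ.mem .pos (nodeRef v))
    (hdem : ∀ c ∈ t.children v, σ'.dem c = σ.dem c) (h : ∃ l, PosList t σ v l) :
    ∃ l, PosList t σ' v l :=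
  let ⟨l, h⟩ := h
  ⟨l, h.congr hpos (fun c _ => by rw [hs .nextPos (by decide)]) hdem⟩

/-- Being untouched depends only on attributes inside the subtree, so calls on sibling subtrees
preserve it. -/
theorem Untouched.congr (hs : ∀ f ∈ staticFields, σ'.mem f = σ.mem f)
    (ha : ∀ w ∈ t.subtree v, Agree σ cells σ' cells' w) (h : Untouched t A B σ cells v) :
    Untouched t A B σ' cells' v :=
  have hv := ha v (self_mem_subtree v)
  ⟨hv.dem.trans h.dem, hv.length.trans h.length, hv.processed.trans h.processed,
    PosList.of_agree hs hv.pos (fun c hc => (ha c (child_mem_subtree hc)).dem) h.posList⟩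

theorem Ready.congr (hs : ∀ f ∈ staticFields, σ'.mem f = σ.mem f)
    (ha : ∀ w ∈ t.subtree u, Agree σ cells σ' cells' w) (h : Ready t A B σ cells u) :
    Ready t A B σ' cells' u :=
  have hu := ha u (self_mem_subtree u)
  ⟨fun c hc v hv => (h.below c hc v hv).congr hs fun w hw =>
      ha w (mem_subtree_of_mem_children hc (mem_subtree_trans hw hv)),
    hu.dem.trans h.dem, by rw [hu.length, h.length], hu.processed.trans h.processed,
    PosList.of_agree hs hu.pos (fun c hc => (ha c (child_mem_subtree hc)).dem) h.posList⟩

/-- With nonpositive demand nothing has to arrive from above, so the call may be made at once. -/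
theorem ready_of_untouched (h : ∀ v ∈ t.subtree u, Untouched t A B σ cells v)
    (hd : t.demand B A u ≤ 0) : Ready t A B σ cells u :=
  have hu := h u (self_mem_subtree u)
  ⟨fun c hc v hv => h v (mem_subtree_of_mem_children hc hv), by rw [hu.dem, min_eq_left hd],
    by rw [hu.length, max_eq_right hd]; rfl, hu.processed, hu.posList⟩

/-- The number of calls to `send_agent` at `v`. -/
noncomputable def sends (t : ParentMap n) (A B : Finset (Fin n)) (v : Fin n) : ℕ :=
  (if v ∈ A then 1 else 0) + (t.demand B A v).toNat +
    ((t.children v).map fun c => (-t.demand B A c).toNat).sum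

/-- The number of calls to `send_agent` at nodes of the subtree of `u`. -/
noncomputable def totalSends (t : ParentMap n) (A B : Finset (Fin n)) (u : Fin n) : ℕ :=
  ∑ v ∈ t.subtree u, sends t A B v

/-- A bound for the number of steps of `direct_traffic(u)`. -/
noncomputable def trafficSteps (t : ParentMap n) (A B : Finset (Fin n)) (u : Fin n) : ℕ :=
  100 * (t.subtree u).card + 50 * totalSends t A B u

/-- The specification of `direct_traffic(u)`. -/
def TrafficSpec (t : ParentMap n) (A B : Finset (Fin n)) (u : Fin n) : Prop :=
  ∀ (σ : State) (cells : Fin n → List ℤ), Input t A B σ → Heap σ cells → σ.reg .u = nodeRef u →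
    Ready t A B σ cells u → Runs n directTrafficCode σ fun σ' N m =>
      (∃ cells', Served t A B u σ cells σ' cells') ∧ N + 40 ≤ trafficSteps t A B u ∧
        m = totalSends t A B u

/-! ### Collecting agents from the children of negative demand -/

/-- The loop of `direct_traffic` over the children of negative demand. -/
def gatherLoop : Stmt :=
  .loop (.ne V (.lit 0)) (block [
    .cond (.lt (.rd .d V) (.lit 0))
      (block [
        .set .w (.lit 0),
        .cond (.lt W (.sub (.rd .s U) (.lit 1))) (.set .w (.sub (.rd .s U) (.lit 1))) .skip,
        .cond (.lt W (.rd .val (.rd .lTail U))) (.set .w (.rd .val (.rd .lTail U))) .skip,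
        .wr .s V W,
        .call .directTraffic V (.lit 0)])
      .skip,
    .set .v (.rd .sib V)])

/-- The loop of `direct_traffic` over the cells of `l(u)`. -/
def sendLoop : Stmt :=
  .loop (.ne C (.lit 0)) (block [
    .call .sendAgent U (.rd .val C),
    .set .c (.rd .link C)])

/-- The loop of `direct_traffic` over the children that are not yet processed. -/
def spreadLoop : Stmt :=
  .loop (.ne V (.lit 0)) (block [
    .cond (.eq (.rd .processed V) (.lit 0)) (.call .directTraffic V (.lit 0)) .skip,
    .set .v (.rd .sib V)])

theorem directTrafficCode_eq : directTrafficCode = block [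
    .cond (.eq (.rd .agent U) (.lit 1)) (insertFront U (.rd .s U)) .skip,
    .set .v (.rd .child U), gatherLoop, .set .c (.rd .lHead U), sendLoop,
    .wr .processed U (.lit 1), .set .v (.rd .child U), spreadLoop] := rfl

/-- The value of the maximum is deliberately forgotten: times never affect demands or lengths of
lists, and their size is controlled by the step count. -/
theorem runs_raise_w {e : Expr} (he : e.mild) :
    Runs n (.cond (.lt W e) (.set .w e) .skip) σ fun σ' N m =>
      (∀ y, y ≠ .w → σ'.reg y = σ.reg y) ∧ σ'.mem = σ.mem ∧ N = 2 ∧ m = 0 := by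
  simp only [runs_cond, runs_set, runs_skip]
  exact ⟨fun _ => ⟨.inl he, fun y hy => by simp [hy], by simp⟩, by simp⟩

theorem Served.of_mem_eq {τ τ' : State} (h : Served t A B u σ cells σ' cells')
    (h₁ : τ.mem = σ.mem) (h₂ : τ'.mem = σ'.mem) : Served t A B u τ cells τ' cells' := by
  obtain ⟨r, m, o⟩ := σ
  obtain ⟨r', m', o'⟩ := σ'
  obtain ⟨_, _, _⟩ := τ
  obtain ⟨_, _, _⟩ := τ'
  subst h₁ h₂
  obtain ⟨h₁, h₂, h₃, h₄, h₅, h₆, h₇, h₈, h₉⟩ := h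
  exact ⟨h₁, h₂.of_mem_eq fun _ _ => rfl, fun v hv hv' => ⟨(h₃ v hv hv').dem, (h₃ v hv hv').pos,
    (h₃ v hv hv').processed, (h₃ v hv hv').length⟩, h₄, h₅, h₆, h₇, h₈, h₉⟩

theorem Ready.of_mem_eq (h : Ready t A B σ cells u) (hm : σ'.mem = σ.mem) :
    Ready t A B σ' cells u :=
  h.congr (fun _ _ => by rw [hm]) fun _ _ =>
    ⟨by rw [State.dem, State.dem, hm], by rw [hm], by rw [hm], rfl⟩

theorem runs_call_directTraffic (h : TrafficSpec t A B v) (hin : Input t A B σ)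
    (hheap : Heap σ cells) (hready : Ready t A B σ cells v) (hv : σ.reg .v = nodeRef v) :
    Runs n (.call .directTraffic V (.lit 0)) σ fun σ' N m => σ'.reg = σ.reg ∧
      (∃ cells', Served t A B v σ cells σ' cells') ∧ N + 39 ≤ trafficSteps t A B v ∧
        m = totalSends t A B v := by
  refine runs_call rfl rfl ((h (σ.enter (σ.reg .v) 0) cells (hin.of_static fun _ _ => rfl)
    (hheap.of_mem_eq fun _ _ => rfl) hv (hready.of_mem_eq rfl)).mono ?_)
  rintro σ₁ N m ⟨⟨cells₁, hs⟩, hN, rfl⟩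
  exact ⟨by simp, fun τ hτr hτm => ⟨hτr, ⟨cells₁, hs.of_mem_eq rfl hτm⟩, by omega, by simp⟩⟩

/-- The invariant of `gatherLoop`. -/
structure GatherInv (t : ParentMap n) (A B : Finset (Fin n)) (u : Fin n) (σ₀ : State)
    (cells₀ : Fin n → List ℤ) (ys : List (Fin n)) (σ : State) (cells : Fin n → List ℤ) :
    Prop where
  reg_u : σ.reg .u = nodeRef u
  reg_v : Linked (σ.mem .sib) (σ.reg .v) (ys.map nodeRef)
  static : ∀ f ∈ staticFields, σ.mem f = σ₀.mem f
  heap : Heap σ cells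
  outside : ∀ v ∉ t.subtree u, Agree σ₀ cells₀ σ cells v
  dem : σ.dem u = σ₀.dem u
  pos : σ.mem .pos (nodeRef u) = σ₀.mem .pos (nodeRef u)
  processed : σ.mem .processed (nodeRef u) = σ₀.mem .processed (nodeRef u)
  todo : ∀ y ∈ ys, ∀ v ∈ t.subtree y, Untouched t A B σ cells v
  done : ∃ xs, t.children u = xs ++ ys ∧
    (cells u).length = (cells₀ u).length + (xs.map fun c => (-t.demand B A c).toNat).sum ∧
    ∀ x ∈ xs, (t.demand B A x < 0 → σ.dem x = 0 ∧ σ.mem .processed (nodeRef x) = 1) ∧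
      (0 ≤ t.demand B A x → ∀ v ∈ t.subtree x, Untouched t A B σ cells v)

theorem not_mem_subtree_sibling {c c' : Fin n} (hc : c ∈ t.children u) (hc' : c' ∈ t.children u)
    (hne : c ≠ c') (hv : v ∈ t.subtree c) : v ∉ t.subtree c' := fun h =>
  hne (eq_of_mem_subtree_children hc hc' hv h)

/-- Serves both branches of the loop body: visiting `y` changes only its subtree and the list of
`u`, so what is known about the siblings persists. -/
theorem GatherInv.step {σ₀ : State} {cells₀ : Fin n → List ℤ} {y : Fin n} {ys : List (Fin n)}
    (h : GatherInv t A B u σ₀ cells₀ (y :: ys) σ cells) (hu : σ'.reg .u = σ.reg .u)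
    (hv : σ'.reg .v = σ.mem .sib (nodeRef y)) (hst : ∀ f ∈ staticFields, σ'.mem f = σ.mem f)
    (hheap : Heap σ' cells') (hag : ∀ v ∉ t.subtree y, v ≠ u → Agree σ cells σ' cells' v)
    (hdem : σ'.dem u = σ.dem u) (hpos : σ'.mem .pos (nodeRef u) = σ.mem .pos (nodeRef u))
    (hproc : σ'.mem .processed (nodeRef u) = σ.mem .processed (nodeRef u))
    (hlen : (cells' u).length = (cells u).length + (-t.demand B A y).toNat)
    (hneg : t.demand B A y < 0 → σ'.dem y = 0 ∧ σ'.mem .processed (nodeRef y) = 1)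
    (hnonneg : 0 ≤ t.demand B A y → ∀ v ∈ t.subtree y, Untouched t A B σ' cells' v) :
    GatherInv t A B u σ₀ cells₀ ys σ' cells' := by
  obtain ⟨hru, hrv, hst₀, hheap₀, hout, hdu, hpu, hqu, htodo, xs, hxs, hlen₀, hdone⟩ := h
  have hy : y ∈ t.children u := by simp [hxs]
  have hnodup := nodup_children (t := t) u
  have hyxs : ∀ x ∈ xs, x ≠ y := fun x hx hxy => by
    rw [hxs, List.nodup_append] at hnodup
    exact hnodup.2.2 x hx y (by simp) hxy
  have hyys : ∀ z ∈ ys, z ≠ y := by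
    rintro z hz rfl
    rw [hxs, List.nodup_append] at hnodup
    exact (List.nodup_cons.1 hnodup.2.1).1 hz
  have hsib : ∀ x ∈ t.children u, x ≠ y → ∀ v ∈ t.subtree x, Agree σ cells σ' cells' v :=
    fun x hx hxy v hv => hag v (not_mem_subtree_sibling hx hy hxy hv)
      (self_not_mem_subtree_child hx hv)
  refine ⟨hu.trans hru, ?_, fun f hf => (hst f hf).trans (hst₀ f hf), hheap, fun v hv => ?_,
    hdem.trans hdu, hpos.trans hpu, hproc.trans hqu, fun z hz v hv => ?_, xs ++ [y], by simp [hxs],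
    ?_, fun x hx => ?_⟩
  · rw [hv, hst .sib (by decide)]
    exact hrv.2.2
  · have h₁ := hout v hv
    have h₂ := hag v (fun h => hv (mem_subtree_of_mem_children hy h))
      (fun h => hv (h ▸ self_mem_subtree _))
    exact ⟨h₂.dem.trans h₁.dem, h₂.pos.trans h₁.pos, h₂.processed.trans h₁.processed,
      h₂.length.trans h₁.length⟩
  · exact (htodo z (by simp [hz]) v hv).congr hst fun w hw =>
      hsib z (by simp [hxs, hz]) (hyys z hz) w (mem_subtree_trans hw hv)
  · rw [hlen, hlen₀]
    simp [add_assoc]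
  · rw [List.mem_append, List.mem_singleton] at hx
    rcases hx with hx | rfl
    · have hag' := hsib x (by simp [hxs, hx]) (hyxs x hx)
      have hx' := hag' x (self_mem_subtree x)
      refine ⟨fun hd => ?_, fun hd v hv => ?_⟩
      · rw [hx'.dem, hx'.processed]
        exact (hdone x hx).1 hd
      · exact ((hdone x hx).2 hd v hv).congr hst fun w hw => hag' w (mem_subtree_trans hw hv)
    · exact ⟨hneg, hnonneg⟩

theorem runs_gatherLoop (ih : ∀ c ∈ t.children u, TrafficSpec t A B c) {σ₀ : State}
    {cells₀ : Fin n → List ℤ} (hin : Input t A B σ₀)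
    (h : GatherInv t A B u σ₀ cells₀ (t.children u) σ cells) :
    Runs n gatherLoop σ fun σ' N m => (∃ cells', GatherInv t A B u σ₀ cells₀ [] σ' cells') ∧
      N ≤ ((t.children u).map fun c =>
        if t.demand B A c < 0 then trafficSteps t A B c - 25 else 12).sum + 1 ∧
      m = ((t.children u).map fun c =>
        if t.demand B A c < 0 then totalSends t A B c else 0).sum := by
  have hN : ∀ c, 100 ≤ trafficSteps t A B c := fun c => by
    have : 0 < (t.subtree c).card := Finset.card_pos.2 ⟨c, self_mem_subtree c⟩
    unfold trafficSteps
    omega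
  refine (runs_loop_list (fun ys σ => ∃ cells, GatherInv t A B u σ₀ cells₀ ys σ cells)
    -- A call leaves 39 steps unused; 13 of them are more than enough for the rest of the loop body.
    (fun c => if t.demand B A c < 0 then trafficSteps t A B c - 26 else 11)
    (fun c => if t.demand B A c < 0 then totalSends t A B c else 0)
    (fun σ ⟨cells, h⟩ => by simpa [Linked] using h.reg_v) ?_ (t.children u) ⟨cells, h⟩).mono ?_
  · rintro y ys σ ⟨cells, h⟩
    obtain ⟨xs, hxs, -⟩ := h.done
    have hy : y ∈ t.children u := by simp [hxs]
    have hrv : σ.reg .v = nodeRef y := h.reg_v.1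
    have hpary : t.par y = u := (mem_children.1 hy).2
    have huy : u ∉ t.subtree y := not_mem_subtree_of_mem_children hy
    have htodo := h.todo y (by simp)
    have hdy : σ.mem .d (nodeRef y) = t.demand B A y := (htodo y (self_mem_subtree y)).dem
    refine ⟨by simpa [hrv] using nodeRef_ne_zero y, ?_⟩
    simp only [block, runs_seq, runs_set, runs_skip]
    rw [runs_cond]
    refine ⟨fun hd => ?_, fun hd => ?_⟩
    · simp [hrv, hdy] at hd
      simp only [runs_seq]
      rw [runs_set]
      refine ⟨.inl rfl, (runs_raise_w rfl).mono ?_⟩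
      rintro σ₁ N₁ m₁ ⟨hreg₁, hmem₁, rfl, rfl⟩
      refine (runs_raise_w rfl).mono ?_
      rintro σ₂ N₂ m₂ ⟨hreg₂, hmem₂, rfl, rfl⟩
      rw [runs_wr]
      refine ⟨.inl rfl, ?_⟩
      generalize hσ₃ : σ₂.write .s (Expr.eval σ₂ V) (Expr.eval σ₂ W) = σ₃
      have hreg₃ : ∀ y, y ≠ .w → σ₃.reg y = σ.reg y := fun y hy => by
        rw [← hσ₃, State.write_reg, hreg₂ y hy, hreg₁ y hy]
        simp [hy]
      have hmem₃ : ∀ f, f ≠ .s → σ₃.mem f = σ.mem f := fun f hf => by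
        rw [← hσ₃, State.write_mem, if_neg hf, hmem₂, hmem₁, State.setReg_mem]
      have hst₃ : ∀ f ∈ staticFields, σ₃.mem f = σ.mem f := fun f hf =>
        hmem₃ f (by rintro rfl; revert hf; decide)
      have hag₃ : ∀ v, Agree σ cells σ₃ cells v := fun v =>
        ⟨congrFun (hmem₃ .d (by decide)) _, by rw [hmem₃ .pos (by decide)],
          by rw [hmem₃ .processed (by decide)], rfl⟩
      refine (runs_call_directTraffic (ih y hy)
        (hin.of_static fun f hf => (hst₃ f hf).trans (h.static f hf))
        (h.heap.of_mem_eq fun f hf => hmem₃ f (by rintro rfl; revert hf; decide))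
        ((ready_of_untouched htodo hd.le).congr hst₃ fun w _ => hag₃ w)
        ((hreg₃ .v (by decide)).trans hrv)).mono ?_
      rintro τ N₄ m₄ ⟨hτr, ⟨cells₄, hs⟩, hN₄, rfl⟩
      have hnpar : t.par y ∉ t.subtree y := hpary ▸ huy
      have hτs : ∀ f ∈ staticFields, τ.mem f = σ.mem f := fun f hf =>
        (hs.static f hf).trans (hst₃ f hf)
      rw [runs_skip]
      refine ⟨.inl rfl, ⟨cells₄, h.step ?_ ?_ hτs (hs.heap.of_mem_eq fun _ _ => rfl)
        (fun v hv hvu => ?_) ?_ ?_ ?_ ?_ (fun _ => ⟨hs.dem, hs.processed⟩) fun h => ?_⟩, ?_, ?_⟩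
      · simp [hτr, hreg₃ .u (by decide)]
      · simp [hτr, hreg₃ .v (by decide), hrv, hτs .sib (by decide)]
      · have h₁ := hs.agree v hv (hpary.symm ▸ hvu)
        have h₂ := hag₃ v
        exact ⟨h₁.dem.trans h₂.dem, h₁.pos.trans h₂.pos, h₁.processed.trans h₂.processed,
          h₁.length.trans h₂.length⟩
      · have := hs.dem_par hnpar
        rw [hpary] at this
        exact this.trans (hag₃ u).dem
      · have := hs.pos_par hnpar
        rw [hpary] at this
        exact this.trans (hag₃ u).pos
      · have := hs.processed_par hnpar
        rw [hpary] at this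
        exact this.trans (hag₃ u).processed
      · have := hs.length_par hnpar
        rwa [hpary] at this
      · exact absurd hd h.not_gt
      · rw [if_pos hd]
        omega
      · rw [if_pos hd]
        omega
    · simp [hrv, hdy] at hd
      rw [runs_skip]
      refine ⟨.inl rfl, ⟨cells, h.step ?_ ?_ (fun _ _ => rfl) (h.heap.of_mem_eq fun _ _ => rfl)
        (fun v _ _ => ⟨rfl, rfl, rfl, rfl⟩) rfl rfl rfl ?_ (fun h => absurd h hd.not_gt)
        fun _ v hv => ?_⟩, ?_, ?_⟩
      · simp
      · simp [hrv]
      · omega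
      · exact Untouched.congr (σ := σ) (cells := cells) (fun _ _ => rfl)
          (fun _ _ => ⟨rfl, rfl, rfl, rfl⟩) (htodo v hv)
      · rw [if_neg hd.not_gt]
        omega
      · rw [if_neg hd.not_gt]
  · rintro σ' N m ⟨h₁, h₂, h₃⟩
    refine ⟨h₁, h₂.trans_eq ?_, h₃⟩
    congr 2
    refine List.map_congr_left fun c _ => ?_
    have := hN c
    split_ifs <;> omega

end RAM

namespace RAM

open UPMT ParentMap

variable {n : ℕ} {t : ParentMap n} {A B : Finset (Fin n)} {σ σ' : State}
  {cells cells' : Fin n → List ℤ} {u v : Fin n}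

/-! ### Sending the agents at a node -/

/-- The potential in the last clause counts the transports still due at `u`; each call lowers it by
one until it is 0. Demand plus list length is constant at each child, and `l(u)` itself is
unchanged, so the caller loops over a fixed list. -/
theorem Send.spec {d d' : Fin n → ℤ} (h : Send t u d cells d' cells')
    (hc : ∀ c ∈ t.children u, 0 ≤ d c) (hu : d u ≤ 0) :
    cells' u = cells u ∧
    (∀ v ∉ t.children u, v ≠ u → d' v = d v ∧
      ((cells' v).length : ℤ) = (cells v).length + if v = t.par u then d' u - d u else 0) ∧
    (∀ c ∈ t.children u, 0 ≤ d' c ∧ d' c + (cells' c).length = d c + (cells c).length) ∧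
    d' u ≤ 0 ∧
    -d' u + ∑ c ∈ (t.children u).toFinset, d' c ≤
      max (-d u + ∑ c ∈ (t.children u).toFinset, d c - 1) 0 := by
  have hne : ∀ c ∈ t.children u, c ≠ u := fun c hc =>
    self_not_mem_subtree_child hc (self_mem_subtree c)
  cases h with
  | up x hd hr =>
    have hpu : t.par u ≠ u := fun h => par_not_mem_subtree hr (h.symm ▸ self_mem_subtree u)
    have hpc : ∀ c ∈ t.children u, c ≠ t.par u := by
      rintro c hc rfl
      exact par_not_mem_subtree hr (child_mem_subtree hc)
    refine ⟨by rw [Function.update_of_ne hpu.symm], fun v _ hv => ⟨by rw [Function.update_of_ne hv],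
      ?_⟩, fun c hc' => ?_, by rw [Function.update_self]; omega, ?_⟩
    · by_cases h : v = t.par u
      · subst h
        simp
      · simp [h]
    · rw [Function.update_of_ne (hne c hc'), Function.update_of_ne (hpc c hc')]
      exact ⟨hc c hc', rfl⟩
    · rw [Finset.sum_update_of_notMem (fun h => hne u (by simpa using h) rfl), Function.update_self]
      omega
  | down v x hd hv hdv =>
    refine ⟨by rw [Function.update_of_ne (hne v hv).symm], fun w hw hwu => ?_, fun c hc' => ?_,
      by rwa [Function.update_of_ne (hne v hv).symm], ?_⟩
    · have : w ≠ v := fun h => hw (h ▸ hv)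
      rw [Function.update_of_ne this, Function.update_of_ne this,
        Function.update_of_ne (hne v hv).symm]
      simp
    · by_cases h : c = v
      · subst h
        simp
        omega
      · rw [Function.update_of_ne h, Function.update_of_ne h]
        exact ⟨hc c hc', rfl⟩
    · have hv' : v ∈ (t.children u).toFinset := by simpa using hv
      rw [Finset.sum_update_of_mem hv', Function.update_of_ne (hne v hv).symm,
        ← Finset.add_sum_erase _ d hv', Finset.sdiff_singleton_eq_erase]
      omega
  | stay hd hle =>
    refine ⟨rfl, fun v _ _ => ⟨rfl, by simp⟩, fun c hc' => ⟨hc c hc', rfl⟩, hu, ?_⟩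
    have : ∑ c ∈ (t.children u).toFinset, d c ≤ 0 :=
      Finset.sum_nonpos fun c hc => hle c (by simpa using hc)
    omega

/-- Ensures that the root never sends an agent to its null parent. -/
theorem Send.dem_root {d d' : Fin n → ℤ} (h : Send t u d cells d' cells') (hr : u = t.root)
    (h₀ : d u = 0) : d' u = 0 := by
  cases h with
  | up c hd hr' => exact absurd hr hr'
  | down v c hd hv _ =>
    rwa [Function.update_of_ne (self_not_mem_subtree_child hv (self_mem_subtree v)).symm]
  | stay => exact h₀

/-- The invariant of `sendLoop`, with the cells `zs` still to be visited. -/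
structure SendInv (t : ParentMap n) (u : Fin n) (σ₀ : State) (cells₀ : Fin n → List ℤ)
    (zs : List ℤ) (σ : State) (cells : Fin n → List ℤ) : Prop where
  reg_u : σ.reg .u = nodeRef u
  reg_c : Linked (σ.mem .link) (σ.reg .c) zs
  static : ∀ f ∈ staticFields, σ.mem f = σ₀.mem f
  processed : σ.mem .processed = σ₀.mem .processed
  heap : Heap σ cells
  suffix : ∃ ws, cells u = ws ++ zs
  posList : ∃ l, PosList t σ u l
  pos : ∀ v : Fin n, v ≠ u → σ.mem .pos (nodeRef v) = σ₀.mem .pos (nodeRef v)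
  outside : ∀ v ∉ t.children u, v ≠ u → σ.dem v = σ₀.dem v ∧
    ((cells v).length : ℤ) = (cells₀ v).length + if v = t.par u then σ.dem u - σ₀.dem u else 0
  child : ∀ c ∈ t.children u, 0 ≤ σ.dem c ∧
    σ.dem c + (cells c).length = σ₀.dem c + (cells₀ c).length
  dem_nonpos : σ.dem u ≤ 0
  dem_root : u = t.root → σ.dem u = 0
  enough : -σ.dem u + ∑ c ∈ (t.children u).toFinset, σ.dem c ≤ zs.length

theorem runs_sendLoop {σ₀ : State} {cells₀ : Fin n → List ℤ} (hin : Input t A B σ₀) {zs : List ℤ}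
    (h : SendInv t u σ₀ cells₀ zs σ cells) :
    Runs n sendLoop σ fun σ' N m => (∃ cells', SendInv t u σ₀ cells₀ [] σ' cells') ∧
      N ≤ 45 * zs.length + 1 ∧ m = zs.length := by
  refine (runs_loop_list (fun zs σ => ∃ cells, SendInv t u σ₀ cells₀ zs σ cells)
    (fun _ => 44) (fun _ => 1) (fun σ ⟨cells, h⟩ => by simpa [Linked] using h.reg_c) ?_ zs
    ⟨cells, h⟩).mono ?_
  · rintro z zs σ ⟨cells, hru, hrc, hst, hproc, hheap, ⟨ws, hws⟩, ⟨l, hl⟩, hpos, hout, hchild, hdu,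
      hroot, henough⟩
    have hrc' : σ.reg .c = z := hrc.1
    refine ⟨by simpa [hrc'] using hrc.2.1, ?_⟩
    simp only [block, runs_seq, runs_set, runs_skip]
    have hcall := runs_sendAgent (t := t) (u := u) (l := l)
      (σ := σ.enter (σ.reg .u) (σ.mem .val (σ.reg .c))) (cells := cells)
      (hheap.of_mem_eq fun _ _ => rfl) hru
      (fun hr => by
        rw [State.enter_mem, hst .par (by decide)]
        exact hin.par u hr)
      (fun hd hr => by
        have := hroot hr
        change σ.dem u < 0 at hd
        omega)
      (hl.congr rfl (fun _ _ => rfl) fun _ _ => rfl)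
    refine runs_call rfl rfl (hcall.mono ?_)
    rintro σ₁ N m ⟨⟨cells₁, hheap₁, hsend⟩, ⟨l₁, hl₁⟩, hpos₁, hmem₁, hN, rfl⟩
    refine ⟨fun _ => hN, fun τ hτr hτm => ⟨.inl rfl, ⟨cells₁, ?_⟩, by omega, by simp⟩⟩
    change Send t u σ.dem cells σ₁.dem cells₁ at hsend
    simp only [State.enter_mem] at hpos₁ hmem₁
    obtain ⟨h₁, h₂, h₃, h₄, h₅⟩ := hsend.spec (fun c hc => (hchild c hc).1) hdu
    have hst₁ : ∀ f ∈ staticFields, σ₁.mem f = σ.mem f := fun f hf =>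
      hmem₁ f (by revert hf; cases f <;> decide) (by rintro rfl; revert hf; decide)
        (by rintro rfl; revert hf; decide)
    generalize hρ : τ.setReg .c (Expr.eval τ (Expr.rd .link C)) = ρ
    have hρm : ρ.mem = σ₁.mem := by rw [← hρ, State.setReg_mem, hτm]
    have hρd : (ρ.dem : Fin n → ℤ) = σ₁.dem := by
      funext v
      rw [State.dem, State.dem, hρm]
    -- The call may have written links, but only to extend other lists: the heap invariant still
    -- threads the unchanged cells of `u`, of which `z :: zs` is a suffix.
    have hlink : ∃ h, Linked (σ₁.mem .link) h (z :: zs) := by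
      have := hheap₁.linked u
      rw [h₁, hws] at this
      exact this.of_append
    obtain ⟨-, -, -, hlink⟩ := hlink
    refine ⟨?_, ?_, fun f hf => ?_, ?_, hheap₁.of_mem_eq fun f _ => by rw [hρm],
      ⟨ws ++ [z], by rw [h₁, hws]; simp⟩, ⟨l₁, hl₁.congr (by rw [hρm]) (fun _ _ => by rw [hρm])
        fun _ _ => by rw [hρd]⟩, fun v hv => ?_, fun v hv hvu => ?_, fun c hc => ?_, ?_, fun hr => ?_,
      ?_⟩
    · simp [← hρ, hτr, hru]
    · rw [hρm, ← hρ]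
      simpa [hτr, hτm, hrc'] using hlink
    · rw [hρm, hst₁ f hf, hst f hf]
    · rw [hρm, hmem₁ _ (by decide) (by decide) (by decide), hproc]
    · rw [hρm, hpos₁ v hv, hpos v hv]
    · obtain ⟨h₆, h₇⟩ := hout v hv hvu
      obtain ⟨h₈, h₉⟩ := h₂ v hv hvu
      rw [hρd]
      refine ⟨h₈.trans h₆, ?_⟩
      rw [h₉, h₇]
      split_ifs <;> ring
    · rw [hρd]
      exact ⟨(h₃ c hc).1, (h₃ c hc).2.trans (hchild c hc).2⟩
    · rw [hρd]
      exact h₄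
    · rw [hρd]
      exact hsend.dem_root hr (hroot hr)
    · rw [hρd]
      simp only [List.length_cons] at henough
      push_cast at henough
      omega
  · rintro σ' N m ⟨h₁, h₂, h₃⟩
    refine ⟨h₁, ?_, by simpa using h₃⟩
    simp at h₂
    omega

/-! ### Serving the remaining children -/

/-- The invariant of `spreadLoop`. -/
structure SpreadInv (t : ParentMap n) (A B : Finset (Fin n)) (u : Fin n) (σ₀ : State)
    (cells₀ : Fin n → List ℤ) (ys : List (Fin n)) (σ : State) (cells : Fin n → List ℤ) :
    Prop where
  reg_u : σ.reg .u = nodeRef u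
  reg_v : Linked (σ.mem .sib) (σ.reg .v) (ys.map nodeRef)
  static : ∀ f ∈ staticFields, σ.mem f = σ₀.mem f
  heap : Heap σ cells
  outside : ∀ v ∉ t.subtree u, Agree σ₀ cells₀ σ cells v
  dem : σ.dem u = σ₀.dem u
  processed : σ.mem .processed (nodeRef u) = σ₀.mem .processed (nodeRef u)
  todo : ∀ y ∈ ys, (t.demand B A y < 0 → σ.mem .processed (nodeRef y) = 1) ∧
    (0 ≤ t.demand B A y → Ready t A B σ cells y)
  done : ∃ xs, t.children u = xs ++ ys

theorem SpreadInv.step {σ₀ : State} {cells₀ : Fin n → List ℤ} {y : Fin n} {ys : List (Fin n)}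
    (h : SpreadInv t A B u σ₀ cells₀ (y :: ys) σ cells) (hu : σ'.reg .u = σ.reg .u)
    (hv : σ'.reg .v = σ.mem .sib (nodeRef y)) (hst : ∀ f ∈ staticFields, σ'.mem f = σ.mem f)
    (hheap : Heap σ' cells') (hag : ∀ v ∉ t.subtree y, v ≠ u → Agree σ cells σ' cells' v)
    (hdem : σ'.dem u = σ.dem u)
    (hproc : σ'.mem .processed (nodeRef u) = σ.mem .processed (nodeRef u)) :
    SpreadInv t A B u σ₀ cells₀ ys σ' cells' := by
  obtain ⟨hru, hrv, hst₀, hheap₀, hout, hdu, hqu, htodo, xs, hxs⟩ := h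
  have hy : y ∈ t.children u := by simp [hxs]
  have hnodup := nodup_children (t := t) u
  refine ⟨hu.trans hru, ?_, fun f hf => (hst f hf).trans (hst₀ f hf), hheap, fun v hv => ?_,
    hdem.trans hdu, hproc.trans hqu, fun z hz => ?_, xs ++ [y], by simp [hxs]⟩
  · rw [hv, hst .sib (by decide)]
    exact hrv.2.2
  · have h₁ := hout v hv
    have h₂ := hag v (fun h => hv (mem_subtree_of_mem_children hy h))
      (fun h => hv (h ▸ self_mem_subtree _))
    exact ⟨h₂.dem.trans h₁.dem, h₂.pos.trans h₁.pos, h₂.processed.trans h₁.processed,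
      h₂.length.trans h₁.length⟩
  · have hzy : z ≠ y := by
      rintro rfl
      rw [hxs, List.nodup_append] at hnodup
      exact (List.nodup_cons.1 hnodup.2.1).1 hz
    have hz' : z ∈ t.children u := by simp [hxs, hz]
    have hag' : ∀ v ∈ t.subtree z, Agree σ cells σ' cells' v := fun v hv =>
      hag v (not_mem_subtree_sibling hz' hy hzy hv) (self_not_mem_subtree_child hz' hv)
    obtain ⟨h₁, h₂⟩ := htodo z (by simp [hz])
    exact ⟨fun hd => (hag' z (self_mem_subtree z)).processed.trans (h₁ hd),
      fun hd => (h₂ hd).congr hst hag'⟩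

theorem runs_spreadLoop (ih : ∀ c ∈ t.children u, TrafficSpec t A B c) {σ₀ : State}
    {cells₀ : Fin n → List ℤ} (hin : Input t A B σ₀)
    (h : SpreadInv t A B u σ₀ cells₀ (t.children u) σ cells) :
    Runs n spreadLoop σ fun σ' N m => (∃ cells', SpreadInv t A B u σ₀ cells₀ [] σ' cells') ∧
      N ≤ ((t.children u).map fun c =>
        if t.demand B A c < 0 then 12 else trafficSteps t A B c - 25).sum + 1 ∧
      m = ((t.children u).map fun c =>
        if t.demand B A c < 0 then 0 else totalSends t A B c).sum := by
  have hN : ∀ c, 100 ≤ trafficSteps t A B c := fun c => by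
    have : 0 < (t.subtree c).card := Finset.card_pos.2 ⟨c, self_mem_subtree c⟩
    unfold trafficSteps
    omega
  refine (runs_loop_list (fun ys σ => ∃ cells, SpreadInv t A B u σ₀ cells₀ ys σ cells)
    (fun c => if t.demand B A c < 0 then 11 else trafficSteps t A B c - 26)
    (fun c => if t.demand B A c < 0 then 0 else totalSends t A B c)
    (fun σ ⟨cells, h⟩ => by simpa [Linked] using h.reg_v) ?_ (t.children u) ⟨cells, h⟩).mono ?_
  · rintro y ys σ ⟨cells, h⟩
    obtain ⟨xs, hxs⟩ := h.done
    have hy : y ∈ t.children u := by simp [hxs]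
    have hrv : σ.reg .v = nodeRef y := h.reg_v.1
    have hpary : t.par y = u := (mem_children.1 hy).2
    have hnpar : t.par y ∉ t.subtree y := hpary ▸ not_mem_subtree_of_mem_children hy
    obtain ⟨htodo₁, htodo₂⟩ := h.todo y (by simp)
    refine ⟨by simpa [hrv] using nodeRef_ne_zero y, ?_⟩
    simp only [block, runs_seq, runs_set]
    rw [runs_cond]
    refine ⟨fun hp => ?_, fun hp => ?_⟩
    -- The mark `processed` records the sign of the initial demand: exactly the children of negative
    -- demand were served before.
    · have hd : 0 ≤ t.demand B A y := by
        by_contra hd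
        simp [hrv, htodo₁ (not_le.1 hd)] at hp
      refine (runs_call_directTraffic (ih y hy) (hin.of_static h.static) h.heap (htodo₂ hd)
        hrv).mono ?_
      rintro τ N₁ m₁ ⟨hτr, ⟨cells₁, hs⟩, hN₁, rfl⟩
      rw [runs_skip]
      refine ⟨.inl rfl, ⟨cells₁, h.step ?_ ?_ hs.static (hs.heap.of_mem_eq fun _ _ => rfl)
        (fun v hv hvu => ?_) ?_ ?_⟩, ?_, ?_⟩
      · simp [hτr]
      · simp [hτr, hrv, hs.static .sib (by decide)]
      · have h₁ := hs.agree v hv (hpary.symm ▸ hvu)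
        exact ⟨h₁.dem, h₁.pos, h₁.processed, h₁.length⟩
      · have := hs.dem_par hnpar
        rwa [hpary] at this
      · have := hs.processed_par hnpar
        rwa [hpary] at this
      · rw [if_neg hd.not_gt]
        omega
      · rw [if_neg hd.not_gt]
        omega
    · have hd : t.demand B A y < 0 := by
        by_contra hd
        exact hp (by simpa [hrv] using (htodo₂ (not_lt.1 hd)).processed)
      rw [runs_skip, runs_skip]
      refine ⟨.inl rfl, ⟨cells, h.step ?_ ?_ (fun _ _ => rfl) (h.heap.of_mem_eq fun _ _ => rfl)
        (fun v _ _ => ⟨rfl, rfl, rfl, rfl⟩) rfl rfl⟩, ?_, ?_⟩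
      · simp
      · simp [hrv]
      · rw [if_pos hd]
        omega
      · rw [if_pos hd]
  · rintro σ' N m ⟨h₁, h₂, h₃⟩
    refine ⟨h₁, h₂.trans_eq ?_, h₃⟩
    congr 2
    refine List.map_congr_left fun c _ => ?_
    have := hN c
    split_ifs <;> omega

end RAM

namespace RAM

open UPMT ParentMap

variable {n : ℕ} {t : ParentMap n} {A B : Finset (Fin n)} {σ σ' : State}
  {cells cells' : Fin n → List ℤ} {u v : Fin n}

/-! ### The whole procedure -/

theorem runs_insert_agent (hin : Input t A B σ) (hheap : Heap σ cells)
    (hu : σ.reg .u = nodeRef u) :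
    Runs n (.cond (.eq (.rd .agent U) (.lit 1)) (insertFront U (.rd .s U)) .skip) σ
      fun σ' N m => (∃ cells', Heap σ' cells' ∧
        (cells' u).length = (cells u).length + (if u ∈ A then 1 else 0) ∧
        ∀ v, v ≠ u → cells' v = cells v) ∧
      σ'.reg .u = nodeRef u ∧ (∀ f, f ∉ heapFields → σ'.mem f = σ.mem f) ∧ N ≤ 13 ∧ m = 0 := by
  rw [runs_cond]
  refine ⟨fun h => ?_, fun h => ?_⟩
  · have hA : u ∈ A := by
      by_contra hA
      simp [hu, hin.agent, hA] at h
    refine (runs_insertFront hheap u rfl rfl fun σ' h => by simp [h, hu]).mono ?_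
    rintro σ' N m ⟨⟨c, hheap'⟩, hreg, hmem, hN, rfl⟩
    exact ⟨⟨_, hheap', by simp [hA], fun v hv => by simp [hv]⟩, by rw [hreg _ (by decide), hu],
      hmem, by omega, rfl⟩
  · have hA : u ∉ A := fun hA => h (by simp [hu, hin.agent, hA])
    rw [runs_skip]
    exact ⟨⟨cells, hheap, by simp [hA], fun _ _ => rfl⟩, hu, fun _ _ => rfl, by omega, rfl⟩

theorem ne_par_of_mem_subtree (hv : v ∈ t.subtree u) (hne : v ≠ u) : v ≠ t.par u := by
  by_cases hr : u = t.root
  · rwa [hr, t.par_root, ← hr]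
  · rintro rfl
    exact par_not_mem_subtree hr hv

/-- Induction from the leaves. The children of negative demand fill `l(u)`, the calls of
`send_agent` bring the demands of `u` and of its children to 0, and this makes the remaining
children ready for their own calls. -/
theorem trafficSpec (h₀ : t.demand B A t.root = 0) (u : Fin n) : TrafficSpec t A B u := by
  induction u using induction_children (t := t) with
  | _ u ih =>
  intro σ cells hin hheap hu hready
  have hnd := nodup_children (t := t) u
  have huu := self_mem_subtree (t := t) u
  rw [directTrafficCode_eq]
  simp only [block, runs_seq]
  refine (runs_insert_agent hin hheap hu).mono ?_
  rintro σ₁ N₁ m₁ ⟨⟨cells₁, hheap₁, hlen₁, hcells₁⟩, hu₁, hmem₁, hN₁, rfl⟩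
  rw [runs_set]
  refine ⟨.inl rfl, ?_⟩
  have hst₁ : ∀ f ∈ staticFields, σ₁.mem f = σ.mem f := fun f hf =>
    hmem₁ f (by revert hf; cases f <;> decide)
  have hag₁ : ∀ v, v ≠ u → Agree σ cells σ₁ cells₁ v := fun v hv =>
    ⟨congrFun (hmem₁ .d (by decide)) _, congrFun (hmem₁ .pos (by decide)) _,
      congrFun (hmem₁ .processed (by decide)) _, by rw [hcells₁ v hv]⟩
  have hdem₁ : ∀ v : Fin n, σ₁.dem v = σ.dem v := fun v => congrFun (hmem₁ .d (by decide)) _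
  have hin₁ := hin.of_static hst₁
  have hbelow₁ : ∀ c ∈ t.children u, ∀ v ∈ t.subtree c, Untouched t A B σ₁ cells₁ v :=
    fun c hc v hv => (hready.below c hc v hv).congr hst₁ fun w hw =>
      hag₁ w (self_not_mem_subtree_child hc (mem_subtree_trans hw hv))
  have hG₁ : GatherInv t A B u σ₁ cells₁ (t.children u)
      (σ₁.setReg .v (Expr.eval σ₁ (.rd .child U))) cells₁ :=
    ⟨by simp [hu₁], by simpa [hu₁] using hin₁.children u, fun _ _ => rfl,
      hheap₁.of_mem_eq fun _ _ => rfl, fun _ _ => ⟨rfl, rfl, rfl, rfl⟩, rfl, rfl, rfl,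
      fun c hc v hv => Untouched.congr (σ := σ₁) (cells := cells₁) (fun _ _ => rfl)
        (fun _ _ => ⟨rfl, rfl, rfl, rfl⟩) (hbelow₁ c hc v hv), [], rfl, by simp, by simp⟩
  refine (runs_gatherLoop ih hin₁ hG₁).mono ?_
  rintro σ₂ N₂ m₂ ⟨⟨cells₂, hG₂⟩, hN₂, rfl⟩
  clear hG₁
  rw [runs_set]
  refine ⟨.inl rfl, ?_⟩
  obtain ⟨xs, hxs, hlen₂, hch₂⟩ := hG₂.done
  rw [List.append_nil] at hxs
  subst hxs
  have hin₂ := hin₁.of_static hG₂.static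
  have hdem₂ : ∀ c ∈ t.children u, σ₂.dem c = max (t.demand B A c) 0 := by
    intro c hc
    rcases lt_or_ge (t.demand B A c) 0 with h | h
    · rw [((hch₂ c hc).1 h).1, max_eq_right h.le]
    · rw [((hch₂ c hc).2 h c (self_mem_subtree c)).dem, max_eq_left h]
  have hdemu₂ : σ₂.dem u = min (t.demand B A u) 0 :=
    hG₂.dem.trans ((hdem₁ u).trans hready.dem)
  -- Arrivals from the parent by readiness, the agent at `u` by the insertion, and arrivals from the
  -- children by the loop just finished.
  have hsends : (cells₂ u).length = sends t A B u := by
    have := hready.length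
    rw [hlen₂, hlen₁, sends]
    omega
  -- The decisive count: by the recursion for the demand, entries minus outstanding transports
  -- equals the indicator of `u ∈ B`, hence is nonnegative.
  have hbalance : -σ₂.dem u + ∑ c ∈ (t.children u).toFinset, σ₂.dem c ≤ (cells₂ u).length := by
    have h₁ : ∑ c ∈ (t.children u).toFinset, σ₂.dem c =
        ∑ c ∈ (t.children u).toFinset, t.demand B A c +
          ∑ c ∈ (t.children u).toFinset, ((-t.demand B A c).toNat : ℤ) := by
      rw [← Finset.sum_add_distrib]
      refine Finset.sum_congr rfl fun c hc => ?_
      rw [hdem₂ c (by simpa using hc)]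
      omega
    have h₂ : t.demand B A u = (if u ∈ B then 1 else 0) - (if u ∈ A then 1 else 0) +
        ∑ c ∈ (t.children u).toFinset, t.demand B A c := by
      rw [List.sum_toFinset _ hnd]
      exact demand_eq u
    rw [hsends, sends, ← List.sum_toFinset _ hnd, h₁, hdemu₂]
    push_cast
    split_ifs at h₂ ⊢ <;> simp at h₂ ⊢ <;> omega
  have hposList : ∃ l, PosList t σ₂ u l := by
    obtain ⟨l, hl⟩ := hready.posList
    refine ⟨l, ?_, hl.nodup, fun c => ?_⟩
    · rw [hG₂.static .nextPos (by decide), hst₁ .nextPos (by decide), hG₂.pos,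
        hmem₁ .pos (by decide)]
      exact hl.linked
    · rw [hl.mem_iff]
      refine and_congr_right fun hc => ?_
      rw [(hready.below c hc c (self_mem_subtree c)).dem, hdem₂ c hc]
      omega
  have hS₂ : SendInv t u σ₂ cells₂ (cells₂ u)
      (σ₂.setReg .c (Expr.eval σ₂ (.rd .lHead U))) cells₂ :=
    ⟨by simp [hG₂.reg_u], by simpa [hG₂.reg_u] using hG₂.heap.linked u, fun _ _ => rfl, rfl,
      hG₂.heap.of_mem_eq fun _ _ => rfl, ⟨[], rfl⟩,
      PosList.of_agree (σ := σ₂) (fun _ _ => rfl) rfl (fun _ _ => rfl) hposList, fun _ _ => rfl,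
      fun v _ _ => ⟨rfl, by simp [State.dem]⟩,
      fun c hc => ⟨(hdem₂ c hc).symm ▸ le_max_right _ _, rfl⟩,
      hdemu₂.symm ▸ min_le_right _ _, fun hr => hdemu₂.trans (by rw [hr, h₀, min_self]), hbalance⟩
  refine (runs_sendLoop hin₂ hS₂).mono ?_
  rintro σ₃ N₃ m₃ ⟨⟨cells₃, hS₃⟩, hN₃, rfl⟩
  clear hS₂
  rw [runs_wr]
  refine ⟨.inl rfl, ?_⟩
  rw [runs_set]
  refine ⟨.inl rfl, ?_⟩
  -- With no cells left, `enough` bounds by 0 a sum of nonnegative terms.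
  have hzero : σ₃.dem u = 0 ∧ ∀ c ∈ t.children u, σ₃.dem c = 0 := by
    have h₁ := hS₃.enough
    have h₂ := hS₃.dem_nonpos
    have h₃ : 0 ≤ ∑ c ∈ (t.children u).toFinset, σ₃.dem c :=
      Finset.sum_nonneg fun c hc => (hS₃.child c (by simpa using hc)).1
    simp only [List.length_nil, Nat.cast_zero] at h₁
    refine ⟨by omega, fun c hc => ?_⟩
    exact (Finset.sum_eq_zero_iff_of_nonneg fun c hc => (hS₃.child c (by simpa using hc)).1).1
      (by omega : ∑ c ∈ (t.children u).toFinset, σ₃.dem c = 0) c (by simpa using hc)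
  generalize hσ₄ : (σ₃.write .processed (Expr.eval σ₃ U) (Expr.eval σ₃ (.lit 1))) = σ₄
  have hreg₄ : σ₄.reg = σ₃.reg := by rw [← hσ₄, State.write_reg]
  have hmem₄ : ∀ f, f ≠ .processed → σ₄.mem f = σ₃.mem f := fun f hf => by
    rw [← hσ₄, State.write_mem, if_neg hf]
  have hproc₄ : σ₄.mem .processed = Function.update (σ₃.mem .processed) (nodeRef u) 1 := by
    rw [← hσ₄]
    simp [hS₃.reg_u]
  have hst₄ : ∀ f ∈ staticFields, σ₄.mem f = σ₂.mem f := fun f hf =>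
    (hmem₄ f (by rintro rfl; revert hf; decide)).trans (hS₃.static f hf)
  have hdem₄ : ∀ v : Fin n, σ₄.dem v = σ₃.dem v := fun v => by
    rw [State.dem, hmem₄ .d (by decide), State.dem]
  have hproc₄' : ∀ v, v ≠ u → σ₄.mem .processed (nodeRef v) = σ₂.mem .processed (nodeRef v) := by
    intro v hv
    rw [hproc₄, Function.update_of_ne (by rwa [Ne, nodeRef_inj]), hS₃.processed]
  have hpos₄ : ∀ v : Fin n, v ≠ u → σ₄.mem .pos (nodeRef v) = σ₂.mem .pos (nodeRef v) := by
    intro v hv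
    rw [hmem₄ .pos (by decide), hS₃.pos v hv]
  have hag₄ : ∀ v, v ∉ t.children u → v ≠ u → v ≠ t.par u → Agree σ₂ cells₂ σ₄ cells₃ v := by
    intro v hv hvu hvp
    obtain ⟨h₁, h₂⟩ := hS₃.outside v hv hvu
    rw [if_neg hvp, add_zero, Nat.cast_inj] at h₂
    exact ⟨(hdem₄ v).trans h₁, hpos₄ v hvu, hproc₄' v hvu, h₂⟩
  -- The demand of `c` fell from its initial value to 0 while demand plus list length stayed
  -- constant, so `l(c)` holds exactly that many arrivals.
  have hready₄ : ∀ c ∈ t.children u, 0 ≤ t.demand B A c → Ready t A B σ₄ cells₃ c := by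
    intro c hc hd
    have hcu := self_not_mem_subtree_child hc (self_mem_subtree c)
    have hU := (hch₂ c hc).2 hd
    have hcU := hU c (self_mem_subtree c)
    have hag : ∀ v ∈ t.subtree c, v ≠ c → Agree σ₂ cells₂ σ₄ cells₃ v := by
      intro v hv hvc
      have hvu := self_not_mem_subtree_child hc hv
      exact hag₄ v (fun h => hvc (eq_of_mem_subtree_children h hc (self_mem_subtree v) hv)) hvu
        (ne_par_of_mem_subtree (mem_subtree_of_mem_children hc hv) hvu)
    have hlen := (hS₃.child c hc).2
    rw [hzero.2 c hc, hcU.dem, hcU.length] at hlen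
    refine ⟨fun c' hc' v hv => ?_, ?_, ?_, (hproc₄' c hcu).trans hcU.processed, ?_⟩
    · exact (hU v (mem_subtree_of_mem_children hc' hv)).congr hst₄ fun w hw =>
        hag w (mem_subtree_of_mem_children hc' (mem_subtree_trans hw hv))
          (self_not_mem_subtree_child hc' (mem_subtree_trans hw hv))
    · rw [hdem₄, hzero.2 c hc, min_eq_right hd]
    · rw [max_eq_left hd]
      omega
    · exact PosList.of_agree hst₄ (hpos₄ c hcu) (fun c' hc' => (hag c' (child_mem_subtree hc')
        (self_not_mem_subtree_child hc' (self_mem_subtree c'))).dem) hcU.posList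
  have hP₄ : SpreadInv t A B u σ₄ cells₃ (t.children u)
      (σ₄.setReg .v (Expr.eval σ₄ (.rd .child U))) cells₃ := by
    refine ⟨by simp [hreg₄, hS₃.reg_u], ?_, fun _ _ => rfl, ?_, fun _ _ => ⟨rfl, rfl, rfl, rfl⟩,
      rfl, rfl, fun c hc => ⟨fun hd => ?_, fun hd => ?_⟩, [], rfl⟩
    · simpa [hreg₄, hS₃.reg_u] using (hin₂.of_static hst₄).children u
    · exact hS₃.heap.of_mem_eq fun f hf => hmem₄ f (by rintro rfl; revert hf; decide)
    · exact (hproc₄' c (self_not_mem_subtree_child hc (self_mem_subtree c))).trans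
        ((hch₂ c hc).1 hd).2
    · exact (hready₄ c hc hd).of_mem_eq rfl
  refine (runs_spreadLoop ih (hin₂.of_static hst₄) hP₄).mono ?_
  rintro σ₅ N₅ m₅ ⟨⟨cells₅, hP₅⟩, hN₅, rfl⟩
  clear hP₄
  rw [runs_skip]
  have htotal : totalSends t A B u = sends t A B u + ((t.children u).map (totalSends t A B)).sum :=
    sum_subtree _ u
  refine ⟨⟨cells₅, ?_⟩, ?_, ?_⟩
  · have hpu : t.par u ∉ t.subtree u → t.par u ∉ t.children u ∧ t.par u ≠ u := fun h =>
      ⟨fun h' => h (child_mem_subtree h'), fun h' => h (h'.symm ▸ huu)⟩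
    refine ⟨fun f hf => ?_, hP₅.heap, fun v hv hvp => ?_, fun h => ?_, fun h => ?_, fun h => ?_,
      fun h => ?_, ?_, ?_⟩
    · rw [hP₅.static f hf, hst₄ f hf, hG₂.static f hf, hst₁ f hf]
    · have hvu : v ≠ u := by
        rintro rfl
        exact hv huu
      have e₁ := hag₁ v hvu
      have e₂ := hG₂.outside v hv
      have e₃ := hag₄ v (fun h => hv (child_mem_subtree h)) hvu hvp
      have e₄ := hP₅.outside v hv
      exact ⟨by rw [e₄.dem, e₃.dem, e₂.dem, e₁.dem], by rw [e₄.pos, e₃.pos, e₂.pos, e₁.pos],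
        by rw [e₄.processed, e₃.processed, e₂.processed, e₁.processed],
        by rw [e₄.length, e₃.length, e₂.length, e₁.length]⟩
    · rw [(hP₅.outside _ h).dem, hdem₄, (hS₃.outside _ (hpu h).1 (hpu h).2).1,
        (hG₂.outside _ h).dem, hdem₁]
    · rw [(hP₅.outside _ h).pos, hpos₄ _ (hpu h).2, (hG₂.outside _ h).pos,
        (hag₁ _ (hpu h).2).pos]
    · rw [(hP₅.outside _ h).processed, hproc₄' _ (hpu h).2, (hG₂.outside _ h).processed,
        (hag₁ _ (hpu h).2).processed]
    -- The demand of `u` rose from `min (demand) 0` to 0, one unit per entry appended at the parent.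
    · have e := (hS₃.outside _ (hpu h).1 (hpu h).2).2
      rw [if_pos rfl, hzero.1, hdemu₂, (hG₂.outside _ h).length, (hag₁ _ (hpu h).2).length] at e
      rw [(hP₅.outside _ h).length]
      omega
    · rw [hP₅.dem, hdem₄, hzero.1]
    · rw [hP₅.processed, hproc₄, Function.update_self]
  · have h₁ : trafficSteps t A B u = 100 + 50 * sends t A B u +
        ((t.children u).map (trafficSteps t A B)).sum := by
      have : ((t.children u).map (trafficSteps t A B)).sum =
          100 * ((t.children u).map fun c => (t.subtree c).card).sum +
            50 * ((t.children u).map (totalSends t A B)).sum := by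
        rw [← List.sum_map_mul_left, ← List.sum_map_mul_left, ← List.sum_map_add]
        rfl
      rw [this, trafficSteps, card_subtree, htotal]
      ring
    -- Both loops visit every child, but only one of them calls it; the other visit, of at most 12
    -- steps, is paid from the 25 saved in the first.
    have h₂ : ((t.children u).map fun c =>
          if t.demand B A c < 0 then trafficSteps t A B c - 25 else 12).sum +
        ((t.children u).map fun c =>
          if t.demand B A c < 0 then 12 else trafficSteps t A B c - 25).sum ≤
        ((t.children u).map (trafficSteps t A B)).sum := by
      rw [← List.sum_map_add]
      refine List.sum_le_sum fun c _ => ?_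
      have : 0 < (t.subtree c).card := Finset.card_pos.2 ⟨c, self_mem_subtree c⟩
      have : 100 ≤ trafficSteps t A B c := by
        unfold trafficSteps
        omega
      split_ifs <;> omega
    rw [hsends] at hN₃
    omega
  · have h₁ : ((t.children u).map fun c =>
          if t.demand B A c < 0 then totalSends t A B c else 0).sum +
        ((t.children u).map fun c => if t.demand B A c < 0 then 0 else totalSends t A B c).sum =
        ((t.children u).map (totalSends t A B)).sum := by
      rw [← List.sum_map_add]
      congr 1
      refine List.map_congr_left fun c _ => ?_
      split_ifs <;> simp
    rw [hsends]
    omega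

end RAM

/-! ## The whole computation -/

namespace RAM

open UPMT ParentMap

variable {n : ℕ} {t : ParentMap n} {A B : Finset (Fin n)} {σ σ' : State}

/-- The loop of the main program that builds the lists of children. -/
def buildLoop : Stmt :=
  .loop (.lt U (.add N (.lit 1))) (block [
    .set .v (.rd .par U),
    .cond (.eq V (.lit 0))
      (.set .w U)
      (block [
        .wr .sib U (.rd .child V),
        .wr .child V U]),
    .set .u (.add U (.lit 1))])

/-- The invariant of `buildLoop`, with the nodes `ys` still to be inserted. -/
structure BuildInv (t : ParentMap n) (σ₀ : State) (ys : List (Fin n)) (σ : State) : Prop where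
  reg_n : σ.reg .n = n
  frame : ∀ f, f ≠ .child → f ≠ .sib → σ.mem f = σ₀.mem f
  done : ∃ xs, List.finRange n = xs ++ ys ∧ σ.reg .u = xs.length + 1 ∧
    (t.root ∈ xs → σ.reg .w = nodeRef t.root) ∧
    ∀ v, Linked (σ.mem .sib) (σ.mem .child (nodeRef v))
      ((xs.filter fun c => c ≠ t.root ∧ t.par c = v).reverse.map nodeRef)

theorem runs_buildLoop {σ₀ : State}
    (hpar : ∀ v, σ₀.mem .par (nodeRef v) = if v = t.root then 0 else nodeRef (t.par v))
    (h : BuildInv t σ₀ (List.finRange n) σ) :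
    Runs n buildLoop σ fun σ' N m => BuildInv t σ₀ [] σ' ∧ N ≤ 10 * n + 1 ∧ m = 0 := by
  refine (runs_loop_list (BuildInv t σ₀) (fun _ => 9) (fun _ => 0) (fun σ h => ?_) ?_ _ h).mono ?_
  · obtain ⟨hn, -, xs, hxs, hu, -⟩ := h
    have := congrArg List.length hxs
    simp at this
    simp [hn, hu, this]
  · rintro y ys σ ⟨hn, hfr, xs, hxs, hu, hw, hch⟩
    -- The next node in `List.finRange` is its own position, so the counter in the register `u` is
    -- its reference.
    have hlen : (y : ℕ) = xs.length := by
      have := congrArg (fun l : List (Fin n) => l[xs.length]?) hxs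
      simp [List.getElem?_eq_some_iff] at this
      obtain ⟨_, h⟩ := this
      rw [← h]
    have huy : σ.reg .u = nodeRef y := by rw [hu, nodeRef, hlen]
    have hnodup := List.nodup_finRange n
    have hyxs : y ∉ xs := fun h => by
      rw [hxs, List.nodup_append] at hnodup
      exact hnodup.2.2 y h y (by simp) rfl
    have hpy : σ.mem .par (nodeRef y) = if y = t.root then 0 else nodeRef (t.par y) := by
      rw [hfr _ (by decide) (by decide), hpar]
    refine ⟨?_, ?_⟩
    · have := y.isLt
      simp only [Test.holds, Expr.eval, huy, hn, nodeRef]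
      omega
    simp only [block, runs_seq, runs_set, runs_skip]
    refine ⟨.inl rfl, ?_⟩
    rw [runs_cond]
    refine ⟨fun hv => ?_, fun hv => ?_⟩
    · simp [huy, hpy, nodeRef_ne_zero] at hv
      rw [runs_set]
      refine ⟨.inl rfl, .inl rfl, ⟨?_, fun f h₁ h₂ => ?_, xs ++ [y], by simp [hxs], ?_, fun _ => ?_,
        fun v => ?_⟩, by omega, by omega⟩
      · simp [hn]
      · simpa using hfr f h₁ h₂
      · simp [hu]
      · simp [huy, hv]
      · have : (xs ++ [y]).filter (fun c => c ≠ t.root ∧ t.par c = v) =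
            xs.filter fun c => c ≠ t.root ∧ t.par c = v := by simp [hv]
        rw [this]
        simpa using hch v
    · have hyr : y ≠ t.root := fun h => hv (by
        rw [if_pos h] at hpy
        simp [huy, hpy])
      rw [if_neg hyr] at hpy
      simp only [runs_seq, runs_wr, runs_skip]
      refine ⟨.inl rfl, .inl rfl, .inl rfl, ⟨?_, fun f h₁ h₂ => ?_, xs ++ [y], by simp [hxs], ?_,
        fun h => ?_, fun v => ?_⟩, by simp, by simp⟩
      · simp [hn]
      · simpa [h₁, h₂] using hfr f h₁ h₂
      · simp [hu]
      · rw [List.mem_append, List.mem_singleton] at h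
        simpa using hw (h.resolve_right (Ne.symm hyr))
      · have hnext : ∀ x ∈ (xs.filter fun c => c ≠ t.root ∧ t.par c = v).reverse.map nodeRef,
            Function.update (σ.mem .sib) (nodeRef y) (σ.mem .child (nodeRef (t.par y))) x =
              σ.mem .sib x := by
          intro x hx
          obtain ⟨c, hc, rfl⟩ := List.mem_map.1 hx
          rw [List.mem_reverse, List.mem_filter] at hc
          rw [Function.update_of_ne]
          rw [Ne, nodeRef_inj]
          rintro rfl
          exact hyxs hc.1
        by_cases hvp : t.par y = v
        · have : (xs ++ [y]).filter (fun c => c ≠ t.root ∧ t.par c = v) =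
              (xs.filter fun c => c ≠ t.root ∧ t.par c = v) ++ [y] := by simp [hyr, hvp]
          rw [this, List.reverse_append, List.reverse_singleton, List.singleton_append,
            List.map_cons]
          refine ⟨by simp [huy, hpy, hvp], nodeRef_ne_zero y, ?_⟩
          simpa [huy, hpy, hvp] using (hch v).congr (hvp ▸ hnext)
        · have : (xs ++ [y]).filter (fun c => c ≠ t.root ∧ t.par c = v) =
              xs.filter fun c => c ≠ t.root ∧ t.par c = v := by simp [hvp]
          rw [this]
          simpa [huy, hpy, nodeRef_inj, Ne.symm hvp] using (hch v).congr hnext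
  · rintro σ' N m ⟨h₁, h₂, h₃⟩
    refine ⟨h₁, ?_, by simpa using h₃⟩
    simp at h₂
    omega

theorem mainCode_eq : mainCode = block [.set .u (.lit 1), buildLoop, .call .demand W (.lit 0),
    .call .directTraffic W (.lit 0)] := rfl

/-- The total number of calls to `send_agent`. -/
theorem totalSends_root (hcard : A.card = B.card) :
    totalSends t A B t.root = t.imbalance B A + A.card := by
  have h₀ : t.demand B A t.root = 0 := demand_root hcard
  -- Every node but the root is counted at its parent, and the root has demand 0. The positive and
  -- negative parts then add up to the absolute values.
  have h₁ : ∑ u, ((t.children u).map fun c => (-t.demand B A c).toNat).sum =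
      ∑ c, (-t.demand B A c).toNat := by
    simp_rw [sum_map_children]
    rw [Finset.sum_comm]
    refine Finset.sum_congr rfl fun c _ => ?_
    by_cases hc : c = t.root <;> simp [hc, h₀]
  have h₂ : t.imbalance B A = ∑ c, (t.demand B A c).toNat + ∑ c, (-t.demand B A c).toNat := by
    rw [imbalance, ← Finset.sum_add_distrib]
    exact Finset.sum_congr rfl fun c _ => by omega
  rw [totalSends, subtree_root]
  simp only [sends, Finset.sum_add_distrib]
  rw [h₁, h₂]
  simp
  ring

/-- The specification of the main program. -/
theorem runs_main (hn : σ.reg .n = n)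
    (hpar : ∀ v, σ.mem .par (nodeRef v) = if v = t.root then 0 else nodeRef (t.par v))
    (hagent : ∀ v, σ.mem .agent (nodeRef v) = if v ∈ A then 1 else 0)
    (htarget : ∀ v, σ.mem .target (nodeRef v) = if v ∈ B then 1 else 0)
    (hzero : ∀ f, f ≠ .par → f ≠ .agent → f ≠ .target → ∀ i, σ.mem f i = 0)
    (hcard : A.card = B.card) :
    Runs n mainCode σ fun _ N m =>
      N ≤ 200 * n + 50 * (t.imbalance B A + A.card) ∧ m = t.imbalance B A + A.card := by
  have hroot := t.root.isLt
  rw [mainCode_eq]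
  simp only [block, runs_seq, runs_set, runs_skip]
  have hbuild : BuildInv t σ (List.finRange n) (σ.setReg .u 1) :=
    ⟨by simp [hn], fun _ _ _ => rfl, [], rfl, by simp, by simp, fun v => by simp [Linked, hzero]⟩
  refine ⟨.inl rfl, (runs_buildLoop hpar hbuild).mono ?_⟩
  rintro σ₁ N₁ m₁ ⟨⟨-, hfr₁, xs, hxs, -, hw, hch⟩, hN₁, rfl⟩
  rw [List.append_nil] at hxs
  subst hxs
  have hw₁ := hw (List.mem_finRange _)
  have hin₁ : Input t A B σ₁ := by
    refine ⟨fun v hv => ?_, hch, fun v => ?_, fun v => ?_⟩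
    · rw [hfr₁ _ (by decide) (by decide), hpar, if_neg hv]
    · rw [hfr₁ _ (by decide) (by decide), hagent]
    · rw [hfr₁ _ (by decide) (by decide), htarget]
  have hcall := runs_demand (t := t) (A := A) (B := B) t.root (σ := σ₁.enter (σ₁.reg .w) 0)
    (hin₁.of_mem_eq fun _ _ => rfl) hw₁
    (fun v _ => by
      rw [State.enter_mem, hfr₁ _ (by decide) (by decide)]
      exact hzero _ (by decide) (by decide) (by decide) _)
  refine runs_call rfl rfl (hcall.mono ?_)
  rintro σ₂ N₂ m₂ ⟨hfr₂, -, hdone₂, hN₂, rfl⟩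
  refine ⟨by simp, fun τ hτr hτm => ?_⟩
  have hτ0 : ∀ f, f ≠ .par → f ≠ .agent → f ≠ .target → f ≠ .child → f ≠ .sib → f ≠ .d →
      f ≠ .pos → f ≠ .nextPos → ∀ i, τ.mem f i = 0 := by
    intro f h₁ h₂ h₃ h₄ h₅ h₆ h₇ h₈ i
    rw [hτm, hfr₂ f h₆ h₇ h₈, State.enter_mem, hfr₁ f h₄ h₅, hzero f h₁ h₂ h₃]
  have hin₂ : Input t A B τ := hin₁.of_mem_eq fun f hf => by
    rw [hτm, hfr₂ f, State.enter_mem] <;> rintro rfl <;> revert hf <;> decide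
  -- The arrays of the lists and of the marks are still zero, so every `l(v)` is empty.
  have hU : ∀ v, Untouched t A B τ (fun _ => []) v := fun v => by
    obtain ⟨h₁, l, h₂⟩ := hdone₂ v (subtree_root ▸ Finset.mem_univ v)
    have hdem : ∀ w : Fin n, τ.dem w = σ₂.dem w := fun w => by rw [State.dem, State.dem, hτm]
    exact ⟨(hdem v).trans h₁, rfl, hτ0 _ (by decide) (by decide) (by decide) (by decide)
      (by decide) (by decide) (by decide) (by decide) _,
      l, h₂.congr (by rw [hτm]) (fun _ _ => by rw [hτm]) fun _ _ => hdem _⟩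
  have hheap : Heap τ (fun _ : Fin n => []) := by
    have h0 : ∀ f ∈ heapFields, ∀ i, τ.mem f i = 0 := fun f hf =>
      hτ0 f (by rintro rfl; revert hf; decide) (by rintro rfl; revert hf; decide)
        (by rintro rfl; revert hf; decide) (by rintro rfl; revert hf; decide)
        (by rintro rfl; revert hf; decide) (by rintro rfl; revert hf; decide)
        (by rintro rfl; revert hf; decide) (by rintro rfl; revert hf; decide)
    exact ⟨fun v => h0 .lHead (by decide) _, fun v => h0 .lTail (by decide) _, by simp, by simp,
      by simp, (h0 .free (by decide) _).ge, fun c _ => h0 .link (by decide) _⟩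
  have h₀ : t.demand B A t.root = 0 := demand_root hcard
  have hspec := trafficSpec h₀ t.root (τ.enter (τ.reg .w) 0) (fun _ => [])
    (hin₂.of_mem_eq fun _ _ => rfl) (hheap.of_mem_eq fun _ _ => rfl)
    (by rw [State.enter_reg_u, hτr, hw₁])
    ((ready_of_untouched (fun v _ => hU v) h₀.le).of_mem_eq rfl)
  refine runs_call rfl rfl (hspec.mono ?_)
  rintro σ₃ N₃ m₃ ⟨-, hN₃, rfl⟩
  refine ⟨by simp, fun τ' _ _ => ?_⟩
  have hcardn : (t.subtree t.root).card = n := by simp [subtree_root]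
  rw [trafficSteps, hcardn, totalSends_root hcard] at hN₃
  rw [hcardn] at hN₂
  rw [totalSends_root hcard]
  refine ⟨?_, by simp⟩
  omega

/-! ### The initial state and the final estimate -/

theorem inputArray_nodeRef (f : Fin n → ℤ) (v : Fin n) : inputArray f (nodeRef v) = f v := by
  have := v.isLt
  have h : 1 ≤ nodeRef v ∧ nodeRef v ≤ n := by
    simp only [nodeRef]
    omega
  rw [inputArray, dif_pos h]
  congr 1
  ext
  simp [nodeRef]

theorem natAbs_inputArray_le {f : Fin n → ℤ} {M : ℕ} (h : ∀ v, (f v).natAbs ≤ M) (i : ℤ) :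
    (inputArray f i).natAbs ≤ M := by
  unfold inputArray
  split_ifs
  · exact h _
  · simp

theorem initState_bdd {T : SimpleGraph (Fin n)} (hT : T.IsTree) (r : Fin n)
    (A B : Finset (Fin n)) : (initState hT r A B).Bdd n := by
  have hr := r.isLt
  refine ⟨fun x => ?_, fun f i => ?_⟩
  · simp only [initState]
    split_ifs <;> simp
  · have hparent : ∀ u : Fin n,
        (if u = r then 0 else nodeRef (UPMT.parent hT r u)).natAbs ≤ n := by
      intro u
      have := (UPMT.parent hT r u).isLt
      simp only [nodeRef]
      split_ifs <;> omega
    have hind : ∀ (S : Finset (Fin n)) (u : Fin n), (if u ∈ S then 1 else 0 : ℤ).natAbs ≤ n := by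
      intro S u
      by_cases h : u ∈ S <;> simp [h]
      omega
    cases f <;> simp only [initState, Int.natAbs_zero, Nat.zero_le]
    · exact natAbs_inputArray_le hparent i
    · exact natAbs_inputArray_le (fun v => by convert hind A v) i
    · exact natAbs_inputArray_le (fun v => by convert hind B v) i

/-- The number of bits of all integers that occur is logarithmic. -/
theorem bits_le_log {X : ℕ} (hn : 2 ≤ n) (hX : 8 * X ≤ 2 ^ 12 * n ^ 2) :
    (bits (8 * X) : ℝ) ≤ 25 * Real.log n := by
  have hn0 : (0 : ℝ) < n := by positivity
  have hsize : (8 * X).size ≤ 12 + 2 * n.size := by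
    rw [Nat.size_le]
    calc 8 * X ≤ 2 ^ 12 * n ^ 2 := hX
      _ < 2 ^ 12 * (2 ^ n.size) ^ 2 := by
        have := Nat.lt_size_self n
        gcongr
      _ = 2 ^ (12 + 2 * n.size) := by rw [pow_add, ← pow_mul, mul_comm 2]
  have hpos : 1 ≤ n.size := Nat.size_pos.2 (by omega)
  have hpow : 2 ^ (n.size - 1) ≤ n := Nat.lt_size.1 (by omega)
  have hlog : ((n.size - 1 : ℕ) : ℝ) * Real.log 2 ≤ Real.log n := by
    rw [← Real.log_pow]
    exact Real.log_le_log (by positivity) (by exact_mod_cast hpow)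
  have hlog2 : Real.log 2 ≤ Real.log n := Real.log_le_log (by norm_num) (by exact_mod_cast hn)
  have h2 := Real.log_two_gt_d9
  rw [Nat.cast_sub hpos, Nat.cast_one] at hlog
  have hs : (1 : ℝ) ≤ n.size := by exact_mod_cast hpos
  have hbits : (bits (8 * X) : ℝ) ≤ 13 + 2 * n.size := by
    have : bits (8 * X) ≤ 13 + 2 * n.size := by
      have : (8 * (X : ℤ)).natAbs = 8 * X := by omega
      rw [bits, this]
      omega
    exact_mod_cast this
  -- With `size n ≤ 1 + log n / log 2` and `log 2 ≤ log n`, the number of bits is at most `17 * log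
  -- n / log 2`, and `17 / log 2 < 25`.
  nlinarith

end RAM

theorem mainTheorem9 :
    ∃ K : ℝ, ∀ (n : ℕ) (T : SimpleGraph (Fin n)) (hT : T.IsTree) (r : Fin n)
      (A B : Finset (Fin n)) (k : ℕ), A.card = k → B.card = k →
      ∃ (σ : RAM.State) (time : ℕ) (calls : List (RAM.Proc × ℕ)),
        RAM.Exec RAM.code 0 (RAM.code .main) (RAM.initState hT r A B) σ time calls ∧
        (RAM.sendAgentTimes calls).length = UPMT.OPT T A B + k ∧
        (2 ≤ n →
          (∀ τ ∈ RAM.sendAgentTimes calls, (τ : ℝ) ≤ K * Real.log n) ∧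
          (time : ℝ) ≤ K * (n * Real.log n + UPMT.OPT T A B * Real.log n)) := by
  -- Any constant from `25 * 25 * 250 = 156250` on would do for the total time; a single call needs
  -- `25 * 25 * 41`.
  refine ⟨200000, fun n T hT r A B k hA hB => ?_⟩
  have hr := r.isLt
  have hcard : A.card = B.card := hA.trans hB.symm
  have hOPT := UPMT.ParentMap.OPT_eq_imbalance (UPMT.describes_parentMap hT r) hcard
  have hle := UPMT.ParentMap.imbalance_le (t := UPMT.parentMap hT r) (B := B) (P := A)
  have hkn : A.card ≤ n := by simpa using Finset.card_le_univ A
  obtain ⟨σ, N, m, hrun, hN, hm⟩ := RAM.runs_main (t := UPMT.parentMap hT r) (A := A) (B := B)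
    (σ := RAM.initState hT r A B) (by simp [RAM.initState])
    (fun v => by
      by_cases h : v = r <;> simp [RAM.initState, RAM.inputArray_nodeRef, UPMT.parentMap, h])
    (fun v => by simp [RAM.initState, RAM.inputArray_nodeRef])
    (fun v => by simp [RAM.initState, RAM.inputArray_nodeRef])
    (fun f h₁ h₂ h₃ i => by cases f <;> first | rfl | contradiction) hcard
  rw [← hOPT] at hN hm hle
  -- The initial values are at most `n`, which is positive as `r` exists, so `n + N` bounds the
  -- integers held in registers and arrays throughout the run.
  obtain ⟨-, time, calls, hexec, htime, hlen, hcalls⟩ := hrun.exists_exec (RAM.code_short .main) 0 n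
    (n + N) (RAM.initState_bdd hT r A B) le_rfl (by omega) (by omega) le_rfl
  refine ⟨σ, time, calls, hexec, by rw [hlen, hm, hA], fun hn => ?_⟩
  have hNle : N ≤ 250 * (n + UPMT.OPT T A B) := by omega
  -- As OPT ≤ n², the value `8 * (n + N)` is at most `8 * 501 * n ^ 2`, below `2 ^ 12 * n ^ 2`.
  have hbits := RAM.bits_le_log (n := n) (X := n + N) hn (by nlinarith)
  have hlog : 0 ≤ Real.log n := Real.log_natCast_nonneg n
  set L := RAM.bits (8 * ((n + N : ℕ) : ℤ))
  refine ⟨fun τ hτ => ?_, ?_⟩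
  · have : (τ : ℝ) ≤ 25 * L * 41 := by exact_mod_cast hcalls τ hτ
    linarith
  · have h₁ : (time : ℝ) ≤ 25 * L * N := by exact_mod_cast htime
    have h₂ : (N : ℝ) ≤ 250 * (n + UPMT.OPT T A B) := by exact_mod_cast hNle
    have h₃ : (0 : ℝ) ≤ n + UPMT.OPT T A B := by positivity
    calc (time : ℝ) ≤ 25 * L * N := h₁
      _ ≤ 25 * (25 * Real.log n) * (250 * (n + UPMT.OPT T A B)) := by gcongr
      _ ≤ 200000 * (n * Real.log n + UPMT.OPT T A B * Real.log n) := by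
        nlinarith [mul_nonneg hlog h₃]
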